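/- **Definitions.** An *implication digraph* on $n$ variables is a digraph on the $2n$ literals $1,\dots,n,\overline 1,\dots,\overline n$ (with $\overline{\overline k}=k$) without arcs between two literals of the same variable, such that $\overline \ell\to\overline k$ is an arc whenever $k\to\ell$ is; equivalently, it is obtained from a 2-CNF formula (a set of clauses, each on two distinct variables) by replacing each clause $k\vee \ell$ by the two arcs $\overline k\to \ell$ and $\overline\ell\to k$. Thus $m$ clauses give $2m$ arcs. A strongly connected component (SCC) of it is *contradictory* if it contains a variable $x$ such that there are oriented paths from $x$ to $\overline x$ and from $\overline x$ to $x$; otherwise it is *ordinary*. Let $\mathrm{Scc}$ be a family of labelled, loopless, nonempty strongly connected digraphs, which is stable under reversing all arcs, and let $\mathrm{Cscc}$ be a family of strongly connected implication digraphs on at least one variable. Digraphs in $\mathrm{Scc}$ with $n$ vertices have vertex set $\{1,\dots,n\}$. An ordinary SCC of an implication digraph *belongs to* $\mathrm{Scc}$ if it becomes a member of $\mathrm{Scc}$ after forgetting the signs of its literals and relabelling its variables increasingly by $1,\dots,k$; a contradictory SCC *belongs to* $\mathrm{Cscc}$ if it becomes a member of $\mathrm{Cscc}$ after relabelling its variables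 increasingly by $1,\dots,k$, keeping the signs. (The families need not be closed under isomorphism; if they are, the order of the labels plays no role.) For a family of digraphs let $a_{n}(w)=\sum_m a_{n,m}w^m$, where $a_{n,m}$ is the number of members with $n$ vertices and $m$ arcs; for a family of implication digraphs let $b_n(w)=\sum_m b_{n,m}w^m$, where $b_{n,m}$ is the number of members with $2n$ vertices and $m$ clauses (i.e. $2m$ arcs). Their exponential generating functions (GFs) are the formal power series $\sum_n a_n(w)\frac{z^n}{n!}$ and $\sum_n b_n(w)\frac{z^n}{n!}$ in $\mathbb Q[[w]][[z]]$, and the *Implication GF* of a family of implication digraphs is $$\sum_{n\ge0}\frac{b_n(w)}{(1+w)^{n(n-1)}}\frac{z^n}{2^n n!}.$$ Put $$\widehat{\mathrm{Set}}(z)=\sum_{n\ge0}\frac{1}{(1+w)^{\binom n2}}\frac{z^n}{n!},\qquad \ddot{\mathrm{Set}}(z)=\sum_{n\ge0}\frac{1}{(1+w)^{n(n-1)}}\frac{z^n}{2^n n!},$$ and let $\odot_z$ be the exponential Hadamard product, $\bigl(\sum_n a_n\frac{z^n}{n!}\bigr)\odot_z\bigl(\sum_n b_n\frac{z^n}{n!}\bigr)=\sum_n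 a_nb_n\frac{z^n}{n!}$. **Proposition.** Let $\mathrm{Scc}(z)$ and $\mathrm{Cscc}(z)$ be the exponential GFs of the families $\mathrm{Scc}$ and $\mathrm{Cscc}$, and let $\ddot{\mathrm{CNF}}_{\mathrm{Scc},\mathrm{Cscc}}(z)$ be the Implication GF of all implication digraphs whose ordinary SCCs all belong to $\mathrm{Scc}$ and whose contradictory SCCs all belong to $\mathrm{Cscc}$. Then the denominator below is invertible in $\mathbb Q[[w]][[z]]$ and $$\ddot{\mathrm{CNF}}_{\mathrm{Scc},\mathrm{Cscc}}(z)=\frac{e^{\mathrm{Cscc}(z)-\mathrm{Scc}(2z)/2}\odot_z\ddot{\mathrm{Set}}(z)}{e^{-\mathrm{Scc}(z)}\odot_z\widehat{\mathrm{Set}}(z)}.$$ -/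

import Mathlib

open PowerSeries

namespace TwoSat

/-! ### Digraphs and strongly connected components -/

/-- There is an oriented path (possibly of length zero) from `u` to `v`. -/
def Reaches {V : Type*} (G : Digraph V) (u v : V) : Prop :=
  Relation.ReflTransGen G.Adj u v

/-- A strongly connected component: a nonempty set of vertices, maximal for inclusion among those
in which any vertex is joined to any other by an oriented path. -/
def IsSCC {V : Type*} (G : Digraph V) (C : Set V) : Prop :=
  Maximal (fun S : Set V => S.Nonempty ∧ ∀ u ∈ S, ∀ v ∈ S, Reaches G u v) C

/-- A digraph with at least one vertex, all of whose vertices reach each other. -/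
def IsStronglyConnected {V : Type*} (G : Digraph V) : Prop :=
  Nonempty V ∧ ∀ u v, Reaches G u v

/-- The digraph with all arcs swapped. -/
def reverse {V : Type*} (G : Digraph V) : Digraph V where
  Adj u v := G.Adj v u

/-- The number of arcs. -/
noncomputable def numArcs {V : Type*} (G : Digraph V) : ℕ :=
  {a : V × V | G.Adj a.1 a.2}.ncard

/-! ### Implication digraphs -/

/-- The `2n` literals of the variables `0, …, n - 1`: `(x, true)` is the variable `x` and
`(x, false)` is its negation. -/
abbrev Literal (n : ℕ) : Type := Fin n × Bool

/-- The negation of a literal. -/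
def Literal.neg {n : ℕ} (l : Literal n) : Literal n := (l.1, !l.2)

/-- Implication digraphs on `n` variables: the digraphs on the `2n` literals that come from 2-CNF
formulae, a clause `k ∨ l` (on two distinct variables) being encoded by the two distinct arcs
`¬k → l` and `¬l → k`. -/
@[ext]
structure ImplicationDigraph (n : ℕ) extends Digraph (Literal n) where
  adj_neg : ∀ k l, Adj k l → Adj l.neg k.neg
  adj_var_ne : ∀ k l, Adj k l → k.1 ≠ l.1

/-- `x` is a contradictory variable. -/
def IsContradictoryVar {n : ℕ} (G : ImplicationDigraph n) (x : Fin n) : Prop :=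
  Reaches G.toDigraph (x, true) (x, false) ∧ Reaches G.toDigraph (x, false) (x, true)

/-- A contradictory SCC: an SCC that contains (a literal of) a contradictory variable. -/
def IsContradictorySCC {n : ℕ} (G : ImplicationDigraph n) (C : Set (Literal n)) : Prop :=
  IsSCC G.toDigraph C ∧ ∃ l ∈ C, IsContradictoryVar G l.1

/-- An ordinary SCC: an SCC that is not contradictory. -/
def IsOrdinarySCC {n : ℕ} (G : ImplicationDigraph n) (C : Set (Literal n)) : Prop :=
  IsSCC G.toDigraph C ∧ ¬ IsContradictorySCC G C

/-! ### Families -/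

/-- A family of labelled digraphs: for each `n` a set of digraphs with vertex set `Fin n`. -/
abbrev DigraphFamily : Type := ∀ n : ℕ, Set (Digraph (Fin n))

/-- A family of implication digraphs: for each `n` a set of implication digraphs on `n` variables. -/
abbrev ImplicationFamily : Type := ∀ n : ℕ, Set (ImplicationDigraph n)

/-- A family of (shapes of) ordinary SCCs: every member is a loopless strongly connected digraph,
and the family is stable under reversing all arcs. (If `C` is an ordinary SCC of an implication
digraph then so is its negation, which, forgetting the signs of the literals, is `C` reversed.) -/
structure IsOrdinarySCCFamily (S : DigraphFamily) : Prop where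
  loopless : ∀ n, ∀ D ∈ S n, ∀ v, ¬ D.Adj v v
  stronglyConnected : ∀ n, ∀ D ∈ S n, IsStronglyConnected D
  reverse_mem : ∀ n, ∀ D ∈ S n, reverse D ∈ S n

/-- A family of contradictory SCCs: every member is a strongly connected implication digraph on at
least one variable (so that all its literals form one contradictory SCC). -/
def IsContradictorySCCFamily (T : ImplicationFamily) : Prop :=
  ∀ n, ∀ H ∈ T n, IsStronglyConnected H.toDigraph

/-- The subgraph of `G` induced on `C` belongs to the digraph family `S`: it is obtained from some
`D` in `S` by relabelling the vertices increasingly by variables (through `e`) and turning some of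
them into negated literals (according to `s`). -/
def InDigraphFamily {n : ℕ} (G : ImplicationDigraph n) (C : Set (Literal n))
    (S : DigraphFamily) : Prop :=
  ∃ (k : ℕ) (e : Fin k ↪o Fin n) (s : Fin k → Bool), ∃ D ∈ S k,
    C = Set.range (fun i => ((e i, s i) : Literal n)) ∧
    ∀ i j, D.Adj i j ↔ G.Adj (e i, s i) (e j, s j)

/-- The subgraph of `G` induced on `C` belongs to the family `T` of implication digraphs: it is
obtained from some `H` in `T` by relabelling the variables increasingly (through `e`). -/
def InImplicationFamily {n : ℕ} (G : ImplicationDigraph n) (C : Set (Literal n))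
    (T : ImplicationFamily) : Prop :=
  ∃ (k : ℕ) (e : Fin k ↪o Fin n), ∃ H ∈ T k,
    C = Set.range (fun a : Literal k => ((e a.1, a.2) : Literal n)) ∧
    ∀ a b, H.Adj a b ↔ G.Adj (e a.1, a.2) (e b.1, b.2)

/-- The implication digraphs all of whose ordinary SCCs belong to `S` and all of whose
contradictory SCCs belong to `T`. -/
def cnfFamily (S : DigraphFamily) (T : ImplicationFamily) : ImplicationFamily := fun _ =>
  {G | (∀ C, IsOrdinarySCC G C → InDigraphFamily G C S) ∧
       (∀ C, IsContradictorySCC G C → InImplicationFamily G C T)}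

/-! ### Generating functions

Series in `z` with coefficients in `ℚ⟦w⟧`; inside `ℚ⟦w⟧`, `PowerSeries.X` is `w`. -/

/-- `ℚ⟦w⟧⟦z⟧`. -/
abbrev Series : Type := PowerSeries (PowerSeries ℚ)

/-- `a_n(w) = ∑ a_{n,m} w^m`, where `a_{n,m}` is the number of members of the family with `n`
vertices and `m` arcs. -/
noncomputable def digraphWeight (A : DigraphFamily) (n : ℕ) : PowerSeries ℚ :=
  PowerSeries.mk fun m => (({D ∈ A n | numArcs D = m}.ncard : ℕ) : ℚ)

/-- `b_n(w) = ∑ b_{n,m} w^m`, where `b_{n,m}` is the number of members of the family with `n`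
variables and `m` clauses, i.e. with `2n` vertices and `2m` arcs. -/
noncomputable def implicationWeight (B : ImplicationFamily) (n : ℕ) : PowerSeries ℚ :=
  PowerSeries.mk fun m => (({G ∈ B n | numArcs G.toDigraph = 2 * m}.ncard : ℕ) : ℚ)

/-- The exponential GF `∑ a_n(w) z^n / n!` of a sequence of weights. -/
noncomputable def egf (a : ℕ → PowerSeries ℚ) : Series :=
  PowerSeries.mk fun n => (1 / (n.factorial : ℚ)) • a n

/-- The implication GF `∑ b_n(w) / (1+w)^{n(n-1)} z^n / (2^n n!)` of a sequence of weights. -/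
noncomputable def implicationGF (b : ℕ → PowerSeries ℚ) : Series :=
  PowerSeries.mk fun n =>
    (1 / (2 ^ n * (n.factorial : ℚ))) • (b n * ((1 + X) ^ (n * (n - 1)))⁻¹)

/-- The graphic GF of sets, `∑ 1 / (1+w)^{binom n 2} z^n / n!`. -/
noncomputable def setGraphic : Series :=
  PowerSeries.mk fun n => (1 / (n.factorial : ℚ)) • ((1 + X) ^ (n.choose 2))⁻¹

/-- The implication GF of sets, `∑ 1 / (1+w)^{n(n-1)} z^n / (2^n n!)`. -/
noncomputable def setImplication : Series :=
  PowerSeries.mk fun n => (1 / (2 ^ n * (n.factorial : ℚ))) • ((1 + X) ^ (n * (n - 1)))⁻¹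

/-- The exponential Hadamard product with respect to `z`:
`(∑ a_n z^n / n!) ⊙ (∑ b_n z^n / n!) = ∑ a_n b_n z^n / n!`. -/
noncomputable def hadamard (A B : Series) : Series :=
  PowerSeries.mk fun n => (n.factorial : ℚ) • (coeff n A * coeff n B)

/-- The exponential `e^A` of a series in `z` without constant term. -/
noncomputable def expSeries (A : Series) : Series :=
  (PowerSeries.exp (PowerSeries ℚ)).subst A

end TwoSat

/-! The proof is a signed double count of pairs `(G, A)`, where `G` is an admissible implication
digraph on `n` variables and `A` is a consistent set of literals that is a union of source
components of `G`. The pair has sign `(-1)` to the number of components in `A` and weight `w` to the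
number of clauses of `G`.

Fix `A`, on `k` variables (`sum_admissible_sourceUnion`). No arc enters `A`, so the clauses of `G`
split into three independent groups. Those inside `A` form isolated ordinary components, each with
sign `-1`, which gives the coefficient of `e^{-Scc}`. Those on the other `n - k` variables form an
arbitrary admissible digraph. The clauses of the arcs leaving `A` are free, and `card_clausesOut`
counts `binom(k,2) + 2k(n-k)` of them. There are `2^k` choices of signs for each set of `k`
variables.

Fix `G`. If some component is not isolated, there is a non-isolated ordinary source component that
can always be toggled in and out of `A`, and the signed sum vanishes
(`sum_sourceUnion_of_not_isSym`). If all components are isolated, each pair `{C, ¬C}` of ordinary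
components contributes `1 - 1 - 1 = -1` and each contradictory component contributes `1`
(`sum_sourceUnion_of_isSym`). A set of `k` variables carries `2^{k-1}` such pairs `{C, ¬C}` of
literal sets, so the exponential formula yields the coefficient of `e^{Cscc(z) - Scc(2z)/2}`
(`atomSum_univ`, `isolatedSum_eq_expCoeff`).

Equating the two counts is `sum_choose_eq_expCoeff`. After division by `(1+w)^{n(n-1)} 2^n n!` it
becomes the product identity of series in `algebraic_identity`. -/

namespace TwoSat

/-! ### Coefficients of exponentials and the exponential formula. -/

/-- The sequence whose exponential GF is the exponential of the exponential GF of `a`. -/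
noncomputable def expCoeff (a : ℕ → PowerSeries ℚ) (n : ℕ) : PowerSeries ℚ :=
  (n.factorial : ℚ) • coeff n (expSeries (egf a))

lemma constantCoeff_egf (a : ℕ → PowerSeries ℚ) (h0 : a 0 = 0) :
    constantCoeff (egf a) = 0 := by
  rw [← coeff_zero_eq_constantCoeff_apply]
  simp [egf, h0]

lemma hasSubst_egf (a : ℕ → PowerSeries ℚ) (h0 : a 0 = 0) : HasSubst (egf a) :=
  HasSubst.of_constantCoeff_zero' (constantCoeff_egf a h0)

lemma coeff_expSeries_egf (a : ℕ → PowerSeries ℚ) (n : ℕ) :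
    coeff n (expSeries (egf a)) = (1 / (n.factorial : ℚ)) • expCoeff a n := by
  rw [expCoeff, smul_smul, one_div, inv_mul_cancel₀ (by positivity), one_smul]

lemma expCoeff_zero (a : ℕ → PowerSeries ℚ) (h0 : a 0 = 0) : expCoeff a 0 = 1 := by
  have h := constantCoeff_subst_eq_zero (constantCoeff_egf a h0)
    (PowerSeries.exp (PowerSeries ℚ) - 1) (by simp)
  have h2 : (PowerSeries.exp (PowerSeries ℚ)) = (PowerSeries.exp (PowerSeries ℚ) - 1) + 1 := by
    ring
  have hs := hasSubst_egf a h0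
  rw [expCoeff, expSeries, h2, subst_add hs]
  have h1 : (1 : Series).subst (egf a) = (1 : Series) := by
    rw [← coe_substAlgHom hs, map_one]
  rw [h1, coeff_zero_eq_constantCoeff_apply, map_add]
  have : constantCoeff (subst (egf a) (PowerSeries.exp (PowerSeries ℚ) - 1)) = 0 := h
  rw [this]
  simp

/-- Coefficient form of `(e^A)' = A' e^A`. Combinatorially, `k + 1` is the size of the block that
contains a distinguished element. -/
lemma expCoeff_succ (a : ℕ → PowerSeries ℚ) (h0 : a 0 = 0) (n : ℕ) :
    expCoeff a (n + 1) = ∑ k ∈ Finset.range (n + 1),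
      (n.choose k : ℚ) • (a (k + 1) * expCoeff a (n - k)) := by
  have hs := hasSubst_egf a h0
  have hd := derivative_subst (f := PowerSeries.exp (PowerSeries ℚ)) hs
  rw [derivative_exp] at hd
  have hc := congrArg (coeff n) hd
  rw [coeff_derivative, mul_comm, mul_comm (subst _ _), coeff_mul,
    Finset.Nat.sum_antidiagonal_eq_sum_range_succ_mk] at hc
  have h1 : expCoeff a (n + 1) = (n.factorial : ℚ) •
      (((n : PowerSeries ℚ) + 1) * coeff (n + 1) (expSeries (egf a))) := by
    rw [expCoeff, Nat.factorial_succ]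
    simp only [Algebra.smul_def]
    push_cast
    ring
  rw [h1, expSeries, hc, Finset.smul_sum]
  refine Finset.sum_congr rfl fun k hk => ?_
  have hk' : k ≤ n := by simpa [Nat.lt_succ_iff] using hk
  have h2 := coeff_expSeries_egf a (n - k)
  rw [expSeries] at h2
  simp only [coeff_derivative]
  rw [h2]
  simp only [egf, coeff_mk, Nat.choose_eq_factorial_div_factorial hk']
  rw [Nat.cast_div (Nat.factorial_mul_factorial_dvd_factorial hk') (by positivity)]
  simp only [Algebra.smul_def]
  have h3 : ((k : PowerSeries ℚ) + 1) = algebraMap ℚ _ ((k : ℚ) + 1) := by simp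
  rw [h3]
  have : algebraMap ℚ (PowerSeries ℚ)
      ((n.factorial : ℚ) / ((k.factorial * (n - k).factorial : ℕ) : ℚ)) =
      algebraMap ℚ (PowerSeries ℚ) ((n.factorial : ℚ) * (1 / ((k + 1).factorial : ℚ)) *
        ((k : ℚ) + 1) * (1 / ((n - k).factorial : ℚ))) := by
    congr 1
    rw [Nat.factorial_succ]
    push_cast
    have := Nat.factorial_ne_zero k
    have := Nat.factorial_ne_zero (n - k)
    have : (k : ℚ) + 1 ≠ 0 := by positivity
    field_simp
  rw [this]
  simp only [map_mul]
  ring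

/-- A function on finite sets that can be computed by splitting off the block of one element
depends on the cardinality only, and is given by the exponential formula. -/
lemma eq_expCoeff_card {α : Type*} [DecidableEq α] (a : ℕ → PowerSeries ℚ) (h0 : a 0 = 0)
    (F : Finset α → PowerSeries ℚ) (W₀ : Finset α) (hF0 : F ∅ = 1)
    (hF : ∀ W ⊆ W₀, ∀ x ∈ W,
      F W = ∑ U ∈ W.powerset with x ∈ U, a U.card * F (W \ U)) :
    ∀ W ⊆ W₀, F W = expCoeff a W.card := by
  intro W
  induction hn : W.card using Nat.strong_induction_on generalizing W with
  | _ n ih =>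
  intro hW
  rcases W.eq_empty_or_nonempty with rfl | ⟨x, hx⟩
  · subst hn; simp [hF0, expCoeff_zero a h0]
  · rw [hF W hW x hx]
    obtain ⟨m, rfl⟩ : ∃ m, n = m + 1 :=
      ⟨n - 1, by have := Finset.card_pos.2 ⟨x, hx⟩; omega⟩
    rw [expCoeff_succ a h0]
    have hce : (W.erase x).card = m := by rw [Finset.card_erase_of_mem hx, hn]; rfl
    have := Finset.sum_powerset_apply_card (x := W.erase x)
      (fun k => a (k + 1) * expCoeff a (m - k))
    rw [hce] at this
    simp only [← Nat.cast_smul_eq_nsmul ℚ] at this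
    rw [← this]
    -- A block containing `x` is the same as a subset of `W.erase x`; this shift by one matches the
    -- index `k + 1` of the recurrence.
    refine Finset.sum_bij' (fun U _ => U.erase x) (fun U _ => insert x U) ?_ ?_ ?_ ?_ ?_
    · intro U hU
      simp only [Finset.mem_filter, Finset.mem_powerset] at hU ⊢
      exact Finset.erase_subset_erase _ hU.1
    · intro U hU
      simp only [Finset.mem_filter, Finset.mem_powerset] at hU ⊢
      exact ⟨Finset.insert_subset hx (hU.trans (Finset.erase_subset _ _)),
        Finset.mem_insert_self _ _⟩
    · intro U hU
      simp only [Finset.mem_filter, Finset.mem_powerset] at hU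
      exact Finset.insert_erase hU.2
    · intro U hU
      simp only [Finset.mem_powerset] at hU
      exact Finset.erase_insert fun h => by simpa using hU h
    · intro U hU
      simp only [Finset.mem_filter, Finset.mem_powerset] at hU
      have h1 : (U.erase x).card + 1 = U.card := Finset.card_erase_add_one hU.2
      have h2 : (W \ U).card = m - (U.erase x).card := by
        rw [Finset.card_sdiff_of_subset hU.1]; omega
      rw [h1, ih _ (by omega) _ h2 (Finset.sdiff_subset.trans hW)]

/-! ### From the identity of coefficients to the identity of series. -/

/-- All normalisations are absorbed here, so that the hypothesis is a purely combinatorial count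
without denominators. -/
lemma algebraic_identity (s t c : ℕ → PowerSeries ℚ)
    (h : ∀ n, ∑ k ∈ Finset.range (n + 1), ((n.choose k : ℚ) * 2 ^ k) •
      ((1 + X) ^ (k.choose 2 + 2 * k * (n - k)) * expCoeff (fun k => -s k) k * c (n - k)) =
      expCoeff (fun k => t k - (2 ^ k / 2 : ℚ) • s k) n) :
    implicationGF c * hadamard (expSeries (-egf s)) setGraphic =
      hadamard (expSeries (egf t - (1 / 2 : ℚ) • rescale (2 : PowerSeries ℚ) (egf s)))
        setImplication := by
  have e1 : -egf s = egf fun k => -s k := by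
    ext n : 1; simp [egf]
  have e2 : egf t - (1 / 2 : ℚ) • rescale (2 : PowerSeries ℚ) (egf s) =
      egf fun k => t k - (2 ^ k / 2 : ℚ) • s k := by
    ext n : 1
    simp only [egf, map_sub, coeff_mk, smul_sub]
    congr 1
    have : coeff n ((1 / 2 : ℚ) • rescale (2 : PowerSeries ℚ)
        (mk fun n => (1 / (n.factorial : ℚ)) • s n)) =
        (1 / 2 : ℚ) • coeff n (rescale (2 : PowerSeries ℚ)
          (mk fun n => (1 / (n.factorial : ℚ)) • s n)) := rfl
    rw [this, coeff_rescale, coeff_mk]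
    have h2 : (2 : PowerSeries ℚ) ^ n = algebraMap ℚ _ (2 ^ n) := by
      rw [map_pow, map_ofNat]
    rw [h2]
    simp only [Algebra.smul_def]
    simp only [← mul_assoc, ← map_mul]
    congr 2
    ring
  rw [e1, e2]
  -- A genuine inverse `q` of `1 + w` replaces the power series inverses, so that the rest is
  -- commutative ring algebra.
  obtain ⟨q, hq1, hq⟩ : ∃ q : PowerSeries ℚ, (1 + X) * q = 1 ∧
      ∀ k, ((1 + X : PowerSeries ℚ) ^ k)⁻¹ = q ^ k := by
    have h1 : constantCoeff (1 + X : PowerSeries ℚ) ≠ 0 := by simp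
    refine ⟨(1 + X)⁻¹, PowerSeries.mul_inv_cancel _ h1, fun k => ?_⟩
    symm
    rw [PowerSeries.eq_inv_iff_mul_eq_one (by simp), ← mul_pow,
      PowerSeries.inv_mul_cancel _ h1, one_pow]
  ext n : 1
  rw [mul_comm, coeff_mul, Finset.Nat.sum_antidiagonal_eq_sum_range_succ_mk]
  simp only [hadamard, implicationGF, setGraphic, setImplication, coeff_mk, hq,
    coeff_expSeries_egf]
  rw [← h n]
  simp only [Finset.smul_sum, Finset.sum_mul]
  refine Finset.sum_congr rfl fun k hk => ?_
  have hk' : k ≤ n := by simpa [Nat.lt_succ_iff] using hk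
  obtain ⟨j, rfl⟩ := Nat.exists_eq_add_of_le hk'
  -- The implication denominator on `k + j` variables is the graphic one on `k`, times the
  -- implication one on `j`, times the factor from the clauses leaving a set of `k` literals.
  have hn : (k + j) * (k + j - 1) = (k.choose 2 + 2 * k * j) + k.choose 2 + j * (j - 1) := by
    have hk2 := Nat.choose_two_right k
    have hev : 2 * (k * (k - 1) / 2) = k * (k - 1) :=
      Nat.mul_div_cancel' (Nat.even_mul_pred_self k).two_dvd
    rw [← hk2] at hev
    have : (k + j) * (k + j - 1) = k * (k - 1) + 2 * k * j + j * (j - 1) := by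
      rcases k with _ | k
      · simp
      · rcases j with _ | j
        · simp
        · simp only [Nat.add_sub_cancel]
          have : k + 1 + (j + 1) - 1 = k + j + 1 := by omega
          rw [this]; ring
    omega
  have hqq : ∀ m, (1 + X : PowerSeries ℚ) ^ m * q ^ m = 1 := fun m => by
    rw [← mul_pow, hq1, one_pow]
  simp only [Nat.add_sub_cancel_left]
  rw [hn, pow_add q, pow_add q]
  simp only [Algebra.smul_def]
  -- The factor `2^k` for the choices of signs turns `1 / (2^j j!)` into the normalisation `1 /
  -- (2^(k+j) (k+j)!)`.
  have key : algebraMap ℚ (PowerSeries ℚ) ((k.factorial : ℚ) * (1 / k.factorial) * (1 / k.factorial)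
      * (1 / (2 ^ j * j.factorial))) =
      algebraMap ℚ (PowerSeries ℚ) (((k + j).factorial : ℚ) * (1 / (k + j).factorial) *
        (((k + j).choose k : ℚ) * 2 ^ k) * (1 / (2 ^ (k + j) * (k + j).factorial))) := by
    congr 1
    have h1 : ((k + j).choose k : ℚ) * k.factorial * j.factorial = (k + j).factorial := by
      have := Nat.add_choose_mul_factorial_mul_factorial k j
      rw [Nat.choose_symm_add]
      exact_mod_cast (by simpa [Nat.choose_symm_add] using this)
    rw [← h1]
    have := Nat.factorial_ne_zero k
    have := Nat.factorial_ne_zero j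
    have : ((k + j).choose k) ≠ 0 := (Nat.choose_pos (by omega)).ne'
    field_simp
    ring
  simp only [map_mul] at key ⊢
  generalize algebraMap ℚ (PowerSeries ℚ) (1 / (2 ^ (k + j) * (k + j).factorial)) = r at key ⊢
  linear_combination (expCoeff (fun k => -s k) k * q ^ (k.choose 2) * c j * q ^ (j * (j - 1))) * key
    - (algebraMap ℚ (PowerSeries ℚ) (((k + j).factorial : ℚ)) *
       algebraMap ℚ (PowerSeries ℚ) (1 / ((k + j).factorial : ℚ)) *
       (algebraMap ℚ (PowerSeries ℚ) ((k + j).choose k : ℚ) *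
        algebraMap ℚ (PowerSeries ℚ) (2 ^ k)) *
       r *
       expCoeff (fun k => -s k) k * q ^ (k.choose 2) * c j * q ^ (j * (j - 1))) *
      hqq (k.choose 2 + 2 * k * j)

/-- The constant coefficient in `z` is `1`, because `e^{-A}` has constant term `1` when `A` has
none. -/
lemma isUnit_hadamard_setGraphic (s : ℕ → PowerSeries ℚ) (h0 : s 0 = 0) :
    IsUnit (hadamard (expSeries (-egf s)) setGraphic) := by
  have e1 : -egf s = egf fun k => -s k := by
    ext n : 1; simp [egf]
  rw [isUnit_iff_constantCoeff, ← coeff_zero_eq_constantCoeff_apply]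
  simp [hadamard, setGraphic, e1, coeff_expSeries_egf, expCoeff_zero (fun k => -s k) (by simp [h0])]

open scoped Classical

/-! ### Literals and their negations. -/

@[simp] lemma Literal.neg_neg {n : ℕ} (l : Literal n) : l.neg.neg = l := by
  simp [Literal.neg]

@[simp] lemma Literal.neg_fst {n : ℕ} (l : Literal n) : l.neg.1 = l.1 := rfl

lemma Literal.neg_injective {n : ℕ} : Function.Injective (Literal.neg (n := n)) := fun a b h => by
  rw [← a.neg_neg, h, b.neg_neg]

lemma Literal.eq_or_eq_neg {n : ℕ} {k l : Literal n} (h : k.1 = l.1) : k = l ∨ k = l.neg := by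
  rcases k with ⟨x, b⟩
  rcases l with ⟨y, c⟩
  obtain rfl : x = y := h
  cases b <;> cases c <;> simp [Literal.neg]

variable {n : ℕ}

/-! ### Sets of clauses and reachability -/

/-- The arc `k → l` of the implication digraph of a set of clauses. -/
def Impl (G : Finset (Sym2 (Literal n))) (k l : Literal n) : Prop := s(k.neg, l) ∈ G

/-- Reachability in the implication digraph of a set of clauses. -/
abbrev Rch (G : Finset (Sym2 (Literal n))) : Literal n → Literal n → Prop :=
  Relation.ReflTransGen (Impl G)

/-- The strongly connected component of a literal. -/
noncomputable def comp (G : Finset (Sym2 (Literal n))) (u : Literal n) : Finset (Literal n) :=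
  Finset.univ.filter fun v => Rch G u v ∧ Rch G v u

/-- The variables of the strongly connected component of `x`. -/
noncomputable def vcomp (G : Finset (Sym2 (Literal n))) (x : Fin n) : Finset (Fin n) :=
  (comp G (x, true)).image Prod.fst

/-- The clauses on two distinct variables of `W`. -/
noncomputable def clausesOn (W : Finset (Fin n)) : Finset (Sym2 (Literal n)) :=
  Finset.univ.filter fun c => ∃ k l : Literal n, c = s(k, l) ∧ k.1 ∈ W ∧ l.1 ∈ W ∧ k.1 ≠ l.1

/-- All components are isolated. -/
def IsSym (G : Finset (Sym2 (Literal n))) : Prop := ∀ u v, Rch G u v → Rch G v u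

/-- No literal is in the set together with its negation. -/
def Consistent (A : Finset (Literal n)) : Prop := ∀ l ∈ A, l.neg ∉ A

lemma mem_clausesOn {W : Finset (Fin n)} {k l : Literal n} :
    s(k, l) ∈ clausesOn W ↔ k.1 ∈ W ∧ l.1 ∈ W ∧ k.1 ≠ l.1 := by
  simp only [clausesOn, Finset.mem_filter, Finset.mem_univ, true_and]
  constructor
  · rintro ⟨a, b, h, ha, hb, hab⟩
    rcases Sym2.eq_iff.1 h with ⟨rfl, rfl⟩ | ⟨rfl, rfl⟩
    · exact ⟨ha, hb, hab⟩
    · exact ⟨hb, ha, hab.symm⟩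
  · exact fun h => ⟨k, l, rfl, h⟩

lemma clausesOn_mono {U W : Finset (Fin n)} (h : U ⊆ W) : clausesOn U ⊆ clausesOn W := by
  intro c
  induction c with | _ k l =>
  simp only [mem_clausesOn]
  exact fun ⟨h1, h2, h3⟩ => ⟨h h1, h h2, h3⟩

lemma clausesOn_disjoint {U V : Finset (Fin n)} (h : Disjoint U V) :
    Disjoint (clausesOn U) (clausesOn V) := by
  rw [Finset.disjoint_left]
  intro c
  induction c with | _ k l =>
  simp only [mem_clausesOn]
  exact fun h1 h2 => Finset.disjoint_left.1 h h1.1 h2.1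

lemma Impl.neg {G : Finset (Sym2 (Literal n))} {k l : Literal n} (h : Impl G k l) :
    Impl G l.neg k.neg := by
  rw [Impl, Literal.neg_neg, Sym2.eq_swap]; exact h

lemma rch_neg {G : Finset (Sym2 (Literal n))} {k l : Literal n} (h : Rch G k l) :
    Rch G l.neg k.neg := by
  induction h with
  | refl => exact .refl
  | tail _ h ih => exact ih.head h.neg

lemma rch_mono {G H : Finset (Sym2 (Literal n))} (h : G ⊆ H) {k l : Literal n} (hr : Rch G k l) :
    Rch H k l :=
  Relation.ReflTransGen.mono (fun _ _ hi => h hi) _ _ hr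

lemma mem_comp {G : Finset (Sym2 (Literal n))} {u v : Literal n} :
    v ∈ comp G u ↔ Rch G u v ∧ Rch G v u := by
  simp [comp]

lemma self_mem_comp (G : Finset (Sym2 (Literal n))) (u : Literal n) : u ∈ comp G u :=
  mem_comp.2 ⟨.refl, .refl⟩

lemma comp_eq_of_mem {G : Finset (Sym2 (Literal n))} {u v : Literal n} (h : v ∈ comp G u) :
    comp G v = comp G u := by
  have h := mem_comp.1 h
  ext w
  simp only [mem_comp]
  exact ⟨fun h' => ⟨h.1.trans h'.1, h'.2.trans h.2⟩, fun h' => ⟨h.2.trans h'.1, h'.2.trans h.1⟩⟩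

lemma mem_comp_neg {G : Finset (Sym2 (Literal n))} {u v : Literal n} :
    v ∈ comp G u.neg ↔ v.neg ∈ comp G u := by
  simp only [mem_comp]
  constructor
  · rintro ⟨h1, h2⟩
    have h1 := rch_neg h1
    have h2 := rch_neg h2
    rw [Literal.neg_neg] at h1 h2
    exact ⟨h2, h1⟩
  · rintro ⟨h1, h2⟩
    have h1 := rch_neg h1
    have h2 := rch_neg h2
    rw [Literal.neg_neg] at h1 h2
    exact ⟨h2, h1⟩

lemma comp_neg (G : Finset (Sym2 (Literal n))) (u : Literal n) :
    comp G u.neg = (comp G u).image Literal.neg := by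
  ext v
  rw [mem_comp_neg, Finset.mem_image]
  exact ⟨fun h => ⟨_, h, v.neg_neg⟩, by rintro ⟨w, hw, rfl⟩; rwa [Literal.neg_neg]⟩

/-- Dichotomy behind ordinary and contradictory components: if `l` and its negation share the
component of `u`, that component equals the one of `u.neg`. Otherwise the two components of a pair
are disjoint. -/
lemma comp_neg_eq_of_not_consistent {G : Finset (Sym2 (Literal n))} {u : Literal n}
    (h : ¬ Consistent (comp G u)) : comp G u.neg = comp G u := by
  simp only [Consistent, not_forall, not_not] at h
  obtain ⟨l, hl, hl'⟩ := h
  rw [← comp_eq_of_mem (mem_comp_neg.2 hl'), comp_eq_of_mem hl]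

lemma consistent_comp_neg {G : Finset (Sym2 (Literal n))} {u : Literal n} :
    Consistent (comp G u.neg) ↔ Consistent (comp G u) := by
  by_cases h : Consistent (comp G u)
  · refine ⟨fun _ => h, fun _ l hl hl' => ?_⟩
    rw [mem_comp_neg] at hl hl'
    exact h _ hl hl'
  · rw [comp_neg_eq_of_not_consistent h]

/-- A component is consistent unless it contains the negation of one given member. -/
lemma consistent_comp_iff {G : Finset (Sym2 (Literal n))} {u : Literal n} :
    Consistent (comp G u) ↔ u.neg ∉ comp G u := by
  refine ⟨fun h => h _ (self_mem_comp _ _), fun h => ?_⟩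
  by_contra h'
  rw [← comp_neg_eq_of_not_consistent h'] at h
  exact h (self_mem_comp _ _)

lemma mem_vcomp {G : Finset (Sym2 (Literal n))} {x y : Fin n} :
    y ∈ vcomp G x ↔ ∃ b, (y, b) ∈ comp G (x, true) := by
  simp [vcomp]

/-- A component and its negation have the same variables, so the sign chosen in `vcomp` does not
matter. -/
lemma image_fst_comp {G : Finset (Sym2 (Literal n))} (u : Literal n) :
    (comp G u).image Prod.fst = vcomp G u.1 := by
  rcases u with ⟨x, b⟩
  cases b
  · have : ((x, false) : Literal n) = Literal.neg (x, true) := rfl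
    rw [this, comp_neg, Finset.image_image]
    rfl
  · rfl

lemma self_mem_vcomp (G : Finset (Sym2 (Literal n))) (x : Fin n) : x ∈ vcomp G x :=
  mem_vcomp.2 ⟨true, self_mem_comp _ _⟩

lemma vcomp_eq_of_mem {G : Finset (Sym2 (Literal n))} {x y : Fin n} (h : y ∈ vcomp G x) :
    vcomp G y = vcomp G x := by
  obtain ⟨b, hb⟩ := mem_vcomp.1 h
  rw [← image_fst_comp (y, b), comp_eq_of_mem hb, image_fst_comp]

lemma isSym_iff {G : Finset (Sym2 (Literal n))} :
    IsSym G ↔ ∀ u v, Impl G u v → Rch G v u := by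
  refine ⟨fun h u v huv => h _ _ (.single huv), fun h u v huv => ?_⟩
  induction huv with
  | refl => exact .refl
  | tail _ h1 ih => exact (h _ _ h1).trans ih

lemma IsSym.mem_comp {G : Finset (Sym2 (Literal n))} (h : IsSym G) {u v : Literal n} :
    v ∈ comp G u ↔ Rch G u v := by
  rw [TwoSat.mem_comp]
  exact ⟨fun h => h.1, fun h' => ⟨h', h _ _ h'⟩⟩

lemma IsSym.vcomp_eq {G : Finset (Sym2 (Literal n))} (h : IsSym G) {u v : Literal n}
    (huv : Impl G u v) : vcomp G u.1 = vcomp G v.1 := by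
  rw [← image_fst_comp, ← image_fst_comp, comp_eq_of_mem (u := u) (v := v)]
  exact h.mem_comp.2 (.single huv)

/-! ### Restriction to a convex set of literals -/

/-- A path between two literals of a convex set never leaves it, so only the arcs inside the set
count. -/
lemma rch_iff_of_convex {G H : Finset (Sym2 (Literal n))} {P : Literal n → Prop} (hHG : H ⊆ G)
    (hG : ∀ u v, P u → P v → Impl G u v → Impl H u v)
    (hP : ∀ u v w, P u → P w → Rch G u v → Rch G v w → P v) {u w : Literal n} (hu : P u)
    (hw : P w) : Rch G u w ↔ Rch H u w := by
  refine ⟨fun h => ?_, rch_mono hHG⟩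
  revert hw
  induction h with
  | refl => exact fun _ => .refl
  | tail h1 h2 ih =>
    intro hw
    have := hP _ _ _ hu hw h1 (.single h2)
    exact (ih this).tail (hG _ _ this hw h2)

lemma comp_eq_of_convex {G H : Finset (Sym2 (Literal n))} {P : Literal n → Prop} (hHG : H ⊆ G)
    (hG : ∀ u v, P u → P v → Impl G u v → Impl H u v)
    (hP : ∀ u v w, P u → P w → Rch G u v → Rch G v w → P v) {u : Literal n} (hu : P u) :
    comp G u = comp H u := by
  ext v
  simp only [mem_comp]
  constructor
  · rintro ⟨h1, h2⟩
    have hv := hP _ _ _ hu hu h1 h2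
    exact ⟨(rch_iff_of_convex hHG hG hP hu hv).1 h1, (rch_iff_of_convex hHG hG hP hv hu).1 h2⟩
  · exact fun h => ⟨rch_mono hHG h.1, rch_mono hHG h.2⟩

lemma fst_mem_of_rch {G : Finset (Sym2 (Literal n))} {W : Finset (Fin n)} (hG : G ⊆ clausesOn W)
    {u v : Literal n} (h : Rch G u v) (hu : u.1 ∈ W) : v.1 ∈ W := by
  induction h with
  | refl => exact hu
  | tail _ h _ => exact (mem_clausesOn.1 (hG h)).2.1

lemma vcomp_subset {G : Finset (Sym2 (Literal n))} {W : Finset (Fin n)} (hG : G ⊆ clausesOn W)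
    {x : Fin n} (hx : x ∈ W) : vcomp G x ⊆ W := by
  intro y hy
  obtain ⟨b, hb⟩ := mem_vcomp.1 hy
  exact fst_mem_of_rch hG (mem_comp.1 hb).1 hx

section split

variable {G : Finset (Sym2 (Literal n))} {U V : Finset (Fin n)}

/-- No clause mixes variables of `U` and `V`, so a path that starts in `U` stays there. -/
lemma rch_split (hG : G ⊆ clausesOn U ∪ clausesOn V) (hUV : Disjoint U V) {u v : Literal n}
    (hu : u.1 ∈ U) : Rch G u v ↔ Rch (G ∩ clausesOn U) u v := by
  refine ⟨fun h => ?_, rch_mono Finset.inter_subset_left⟩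
  induction h with
  | refl => exact .refl
  | tail _ h ih =>
    refine ih.tail ?_
    have h1 := fst_mem_of_rch Finset.inter_subset_right ih hu
    refine Finset.mem_inter.2 ⟨h, ?_⟩
    rcases Finset.mem_union.1 (hG h) with h2 | h2
    · exact h2
    · exact absurd (mem_clausesOn.1 h2).1 (Finset.disjoint_left.1 hUV h1)

lemma comp_split (hG : G ⊆ clausesOn U ∪ clausesOn V) (hUV : Disjoint U V) {u : Literal n}
    (hu : u.1 ∈ U) : comp G u = comp (G ∩ clausesOn U) u := by
  ext v
  simp only [mem_comp]
  constructor
  · rintro ⟨h1, h2⟩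
    rw [rch_split hG hUV hu] at h1
    exact ⟨h1, (rch_split hG hUV (fst_mem_of_rch Finset.inter_subset_right h1 hu)).1 h2⟩
  · exact fun h => ⟨rch_mono Finset.inter_subset_left h.1, rch_mono Finset.inter_subset_left h.2⟩

lemma vcomp_split (hG : G ⊆ clausesOn U ∪ clausesOn V) (hUV : Disjoint U V) {x : Fin n}
    (hx : x ∈ U) : vcomp G x = vcomp (G ∩ clausesOn U) x := by
  rw [vcomp, comp_split hG hUV hx, vcomp]

lemma isSym_split_left (hG : G ⊆ clausesOn U ∪ clausesOn V) (hUV : Disjoint U V) (h : IsSym G) :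
    IsSym (G ∩ clausesOn U) := by
  rw [isSym_iff]
  intro u v huv
  have hc := mem_clausesOn.1 (Finset.mem_inter.1 huv).2
  exact (rch_split hG hUV hc.2.1).1 (h _ _ (.single (Finset.mem_inter.1 huv).1))

lemma isSym_split (hG : G ⊆ clausesOn U ∪ clausesOn V) (hU : IsSym (G ∩ clausesOn U))
    (hV : IsSym (G ∩ clausesOn V)) : IsSym G := by
  rw [isSym_iff]
  intro u v huv
  rcases Finset.mem_union.1 (hG huv) with h | h
  · exact rch_mono Finset.inter_subset_left (hU _ _ (.single (Finset.mem_inter.2 ⟨huv, h⟩)))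
  · exact rch_mono Finset.inter_subset_left (hV _ _ (.single (Finset.mem_inter.2 ⟨huv, h⟩)))

end split

/-! ### Admissible components -/

/-- `InDigraphFamily` for the implication digraph of a set of clauses. -/
def InOrd (S : DigraphFamily) (G : Finset (Sym2 (Literal n))) (C : Finset (Literal n)) : Prop :=
  ∃ (k : ℕ) (e : Fin k ↪o Fin n) (s : Fin k → Bool), ∃ D ∈ S k,
    (C : Set (Literal n)) = Set.range (fun i => ((e i, s i) : Literal n)) ∧
    ∀ i j, D.Adj i j ↔ Impl G (e i, s i) (e j, s j)

/-- `InImplicationFamily` for the implication digraph of a set of clauses. -/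
def InContr (T : ImplicationFamily) (G : Finset (Sym2 (Literal n))) (C : Finset (Literal n)) :
    Prop :=
  ∃ (k : ℕ) (e : Fin k ↪o Fin n), ∃ H ∈ T k,
    (C : Set (Literal n)) = Set.range (fun a : Literal k => ((e a.1, a.2) : Literal n)) ∧
    ∀ a b, H.Adj a b ↔ Impl G (e a.1, a.2) (e b.1, b.2)

/-- A component that is allowed by the two families. -/
def Admissible (S : DigraphFamily) (T : ImplicationFamily) (G : Finset (Sym2 (Literal n)))
    (C : Finset (Literal n)) : Prop :=
  (Consistent C → InOrd S G C) ∧ (¬ Consistent C → InContr T G C)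

/-- All components with variables in `W` are allowed. -/
def AdmissibleOn (S : DigraphFamily) (T : ImplicationFamily) (G : Finset (Sym2 (Literal n)))
    (W : Finset (Fin n)) : Prop :=
  ∀ u : Literal n, u.1 ∈ W → Admissible S T G (comp G u)

section

variable {S : DigraphFamily} {T : ImplicationFamily} {G H : Finset (Sym2 (Literal n))}
  {C : Finset (Literal n)}

lemma InOrd.congr (h : ∀ u ∈ C, ∀ v ∈ C, (Impl G u v ↔ Impl H u v)) (hG : InOrd S G C) :
    InOrd S H C := by
  obtain ⟨k, e, s, D, hD, hC, hadj⟩ := hG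
  have hm : ∀ i, ((e i, s i) : Literal n) ∈ C := fun i => by
    rw [← Finset.mem_coe, hC]; exact ⟨i, rfl⟩
  exact ⟨k, e, s, D, hD, hC, fun i j => (hadj i j).trans (h _ (hm i) _ (hm j))⟩

lemma InContr.congr (h : ∀ u ∈ C, ∀ v ∈ C, (Impl G u v ↔ Impl H u v)) (hG : InContr T G C) :
    InContr T H C := by
  obtain ⟨k, e, D, hD, hC, hadj⟩ := hG
  have hm : ∀ a : Literal k, ((e a.1, a.2) : Literal n) ∈ C := fun a => by
    rw [← Finset.mem_coe, hC]; exact ⟨a, rfl⟩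
  exact ⟨k, e, D, hD, hC, fun a b => (hadj a b).trans (h _ (hm a) _ (hm b))⟩

lemma admissible_congr (h : ∀ u ∈ C, ∀ v ∈ C, (Impl G u v ↔ Impl H u v)) :
    Admissible S T G C ↔ Admissible S T H C :=
  ⟨fun hG => ⟨fun h' => (hG.1 h').congr h, fun h' => (hG.2 h').congr h⟩,
    fun hG => ⟨fun h' => (hG.1 h').congr fun u hu v hv => (h u hu v hv).symm,
      fun h' => (hG.2 h').congr fun u hu v hv => (h u hu v hv).symm⟩⟩

/-- Negation reverses arcs; this is where stability of the family under reversal enters. -/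
lemma InOrd.neg (hS : IsOrdinarySCCFamily S) (hG : InOrd S G C) :
    InOrd S G (C.image Literal.neg) := by
  obtain ⟨k, e, s, D, hD, hC, hadj⟩ := hG
  refine ⟨k, e, fun i => !s i, reverse D, hS.reverse_mem _ _ hD, ?_, fun i j => ?_⟩
  · rw [Finset.coe_image, hC, ← Set.range_comp]
    rfl
  · change D.Adj j i ↔ _
    rw [hadj]
    exact ⟨fun h => h.neg, fun h => by simpa [Literal.neg] using h.neg⟩

lemma admissible_comp_neg (hS : IsOrdinarySCCFamily S) {u : Literal n}
    (h : Admissible S T G (comp G u)) : Admissible S T G (comp G u.neg) := by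
  by_cases hc : Consistent (comp G u)
  · refine ⟨fun _ => ?_, fun h' => absurd (consistent_comp_neg.2 hc) h'⟩
    rw [comp_neg]
    exact (h.1 hc).neg hS
  · rwa [comp_neg_eq_of_not_consistent hc]

/-- The connected literals of an ordinary family member reach each other inside the member. -/
lemma InOrd.rch (hS : IsOrdinarySCCFamily S) (hG : InOrd S G C) {u v : Literal n} (hu : u ∈ C)
    (hv : v ∈ C) : Rch G u v := by
  obtain ⟨k, e, s, D, hD, hC, hadj⟩ := hG
  rw [← Finset.mem_coe, hC] at hu hv
  obtain ⟨i, rfl⟩ := hu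
  obtain ⟨j, rfl⟩ := hv
  exact Relation.ReflTransGen.lift (fun i => ((e i, s i) : Literal n))
    (fun a b h => (hadj a b).1 h) _ _ ((hS.stronglyConnected _ _ hD).2 i j)

lemma InContr.rch (hT : IsContradictorySCCFamily T) (hG : InContr T G C) {u v : Literal n}
    (hu : u ∈ C) (hv : v ∈ C) : Rch G u v := by
  obtain ⟨k, e, D, hD, hC, hadj⟩ := hG
  rw [← Finset.mem_coe, hC] at hu hv
  obtain ⟨i, rfl⟩ := hu
  obtain ⟨j, rfl⟩ := hv
  exact Relation.ReflTransGen.lift (fun a : Literal k => ((e a.1, a.2) : Literal n))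
    (fun a b h => (hadj a b).1 h) _ _ ((hT _ _ hD).2 i j)

lemma admissible_split {U V : Finset (Fin n)} (hG : G ⊆ clausesOn U ∪ clausesOn V)
    (hUV : Disjoint U V) {u : Literal n} (hu : u.1 ∈ U) :
    Admissible S T G (comp G u) ↔
      Admissible S T (G ∩ clausesOn U) (comp (G ∩ clausesOn U) u) := by
  rw [← comp_split hG hUV hu]
  refine admissible_congr fun v hv w hw => ?_
  rw [comp_split hG hUV hu] at hv hw
  have h1 := fst_mem_of_rch Finset.inter_subset_right (mem_comp.1 hv).1 hu
  refine ⟨fun h => Finset.mem_inter.2 ⟨h, ?_⟩, fun h => (Finset.mem_inter.1 h).1⟩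
  rcases Finset.mem_union.1 (hG h) with h2 | h2
  · exact h2
  · exact absurd (mem_clausesOn.1 h2).1 (Finset.disjoint_left.1 hUV h1)

end

/-! ### Digraphs whose components are isolated -/

/-- `-1` for the variables of a pair of ordinary components and `1` for the variables of a
contradictory component. -/
noncomputable def compSign (G : Finset (Sym2 (Literal n))) (U : Finset (Fin n)) : PowerSeries ℚ :=
  if ∀ x ∈ U, Consistent (comp G (x, true)) then -1 else 1

/-- The signed weight of the admissible digraphs on `W` with isolated components, all of whose
clauses are in `K`. -/
noncomputable def isolatedSum (S : DigraphFamily) (T : ImplicationFamily)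
    (K : Finset (Sym2 (Literal n))) (W : Finset (Fin n)) : PowerSeries ℚ :=
  ∑ G ∈ (clausesOn W ∩ K).powerset with IsSym G ∧ AdmissibleOn S T G W,
    (∏ U ∈ W.image (vcomp G), compSign G U) * X ^ G.card

/-- The signed weight of the admissible components, or pairs of components, with set of variables
`U`, all of whose clauses are in `K`. -/
noncomputable def atomSum (S : DigraphFamily) (T : ImplicationFamily)
    (K : Finset (Sym2 (Literal n))) (U : Finset (Fin n)) : PowerSeries ℚ :=
  ∑ G ∈ (clausesOn U ∩ K).powerset with
    IsSym G ∧ AdmissibleOn S T G U ∧ ∀ x ∈ U, vcomp G x = U, compSign G U * X ^ G.card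

section

variable {S : DigraphFamily} {T : ImplicationFamily} {G : Finset (Sym2 (Literal n))}
  {U V W : Finset (Fin n)}

lemma admissibleOn_split_left (hG : G ⊆ clausesOn U ∪ clausesOn V) (hUV : Disjoint U V)
    (h : ∀ u : Literal n, u.1 ∈ U → Admissible S T G (comp G u)) :
    AdmissibleOn S T (G ∩ clausesOn U) U :=
  fun u hu => (admissible_split hG hUV hu).1 (h u hu)

lemma admissibleOn_split (hG : G ⊆ clausesOn U ∪ clausesOn V) (hUV : Disjoint U V)
    (hU : AdmissibleOn S T (G ∩ clausesOn U) U) (hV : AdmissibleOn S T (G ∩ clausesOn V) V) :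
    AdmissibleOn S T G (U ∪ V) := by
  intro u hu
  rcases Finset.mem_union.1 hu with h | h
  · exact (admissible_split hG hUV h).2 (hU u h)
  · exact (admissible_split (by rwa [Finset.union_comm]) hUV.symm h).2 (hV u h)

lemma compSign_split (hG : G ⊆ clausesOn U ∪ clausesOn V) (hUV : Disjoint U V)
    {U' : Finset (Fin n)} (hU' : U' ⊆ U) : compSign G U' = compSign (G ∩ clausesOn U) U' := by
  unfold compSign
  congr 1
  refine propext (forall₂_congr fun x hx => ?_)
  rw [comp_split hG hUV (u := (x, true)) (hU' hx)]

lemma image_vcomp_split (hG : G ⊆ clausesOn U ∪ clausesOn V) (hUV : Disjoint U V) :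
    U.image (vcomp G) = U.image (vcomp (G ∩ clausesOn U)) :=
  Finset.image_congr fun _ hx => vcomp_split hG hUV hx

/-- When all components are isolated, both variables of a clause lie in the same class `vcomp`. -/
lemma subset_clausesOn_of_isSym (hG : G ⊆ clausesOn W) (hs : IsSym G) (x : Fin n) :
    G ⊆ clausesOn (vcomp G x) ∪ clausesOn (W \ vcomp G x) := by
  intro c hc
  induction c with | _ k l =>
  have h1 : Impl G k.neg l := by rwa [Impl, Literal.neg_neg]
  have h2 := hs.vcomp_eq h1
  have h3 := mem_clausesOn.1 (hG hc)
  rw [Literal.neg_fst] at h2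
  by_cases hk : k.1 ∈ vcomp G x
  · have hl : l.1 ∈ vcomp G x := by
      rw [← vcomp_eq_of_mem hk, h2]; exact self_mem_vcomp _ _
    exact Finset.mem_union_left _ (mem_clausesOn.2 ⟨hk, hl, h3.2.2⟩)
  · have hl : l.1 ∉ vcomp G x := fun hl => hk (by
      rw [← vcomp_eq_of_mem hl, ← h2]; exact self_mem_vcomp _ _)
    exact Finset.mem_union_right _ (mem_clausesOn.2
      ⟨Finset.mem_sdiff.2 ⟨h3.1, hk⟩, Finset.mem_sdiff.2 ⟨h3.2.1, hl⟩, h3.2.2⟩)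

lemma isolatedSum_empty (S : DigraphFamily) (T : ImplicationFamily)
    (K : Finset (Sym2 (Literal n))) : isolatedSum S T K ∅ = 1 := by
  have h0 : clausesOn (∅ : Finset (Fin n)) = ∅ := by
    ext c
    induction c with | _ k l => simp [mem_clausesOn]
  have hs : IsSym (∅ : Finset (Sym2 (Literal n))) := by
    rw [isSym_iff]
    intro u v h
    simp [Impl] at h
  have ha : AdmissibleOn S T (∅ : Finset (Sym2 (Literal n))) ∅ := fun u hu => by simp at hu
  rw [isolatedSum, h0, Finset.empty_inter, Finset.powerset_empty, Finset.filter_singleton,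
    if_pos ⟨hs, ha⟩]
  simp

/-- Digraphs are sorted by the class `U` of `x`. Isolation splits the clauses into those on `U` and
those on the rest, and weights and signs are multiplicative. -/
lemma isolatedSum_eq_sum_atomSum (K : Finset (Sym2 (Literal n))) {x : Fin n} (hx : x ∈ W) :
    isolatedSum S T K W =
      ∑ U ∈ W.powerset with x ∈ U, atomSum S T K U * isolatedSum S T K (W \ U) := by
  rw [isolatedSum, ← Finset.sum_fiberwise_of_maps_to (g := fun G => vcomp G x)
    (t := W.powerset.filter fun U => x ∈ U)]
  swap
  · intro G hG
    simp only [Finset.mem_filter, Finset.mem_powerset] at hG ⊢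
    exact ⟨vcomp_subset (hG.1.trans Finset.inter_subset_left) hx, self_mem_vcomp _ _⟩
  refine Finset.sum_congr rfl fun U hU => ?_
  simp only [Finset.mem_filter, Finset.mem_powerset] at hU
  obtain ⟨hUW, hxU⟩ := hU
  have hd : Disjoint U (W \ U) := Finset.disjoint_sdiff
  have hUn : U ∪ (W \ U) = W := Finset.union_sdiff_of_subset hUW
  rw [atomSum, isolatedSum, Finset.sum_mul_sum, ← Finset.sum_product']
  have cap : ∀ {H₁ H₂ : Finset (Sym2 (Literal n))}, H₁ ⊆ clausesOn U → H₂ ⊆ clausesOn (W \ U) →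
      (H₁ ∪ H₂) ∩ clausesOn U = H₁ ∧ (H₁ ∪ H₂) ∩ clausesOn (W \ U) = H₂ := by
    intro H₁ H₂ h1 h2
    have hdc := clausesOn_disjoint hd
    constructor
    · rw [Finset.union_inter_distrib_right, Finset.inter_eq_left.2 h1,
        Finset.disjoint_iff_inter_eq_empty.1 (hdc.symm.mono_left h2), Finset.union_empty]
    · rw [Finset.union_inter_distrib_right, Finset.inter_eq_left.2 h2,
        Finset.disjoint_iff_inter_eq_empty.1 (hdc.mono_left h1), Finset.empty_union]
  refine Finset.sum_bij' (fun G _ => (G ∩ clausesOn U, G ∩ clausesOn (W \ U)))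
    (fun p _ => p.1 ∪ p.2) ?_ ?_ ?_ ?_ ?_
  · intro G hG
    simp only [Finset.mem_filter, Finset.mem_powerset, Finset.mem_product] at hG ⊢
    obtain ⟨⟨hGs, hsym, hadm⟩, hv⟩ := hG
    have hsub := subset_clausesOn_of_isSym (hGs.trans Finset.inter_subset_left) hsym x
    rw [hv] at hsub
    have hsub' : G ⊆ clausesOn (W \ U) ∪ clausesOn U := by rwa [Finset.union_comm]
    refine ⟨⟨?_, isSym_split_left hsub hd hsym, admissibleOn_split_left hsub hd
      fun u hu => hadm u (hUW hu), fun y hy => ?_⟩, ?_, isSym_split_left hsub' hd.symm hsym,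
      admissibleOn_split_left hsub' hd.symm fun u hu => hadm u (Finset.sdiff_subset hu)⟩
    · exact fun c hc => Finset.mem_inter.2 ⟨(Finset.mem_inter.1 hc).2,
        (Finset.mem_inter.1 (hGs (Finset.mem_inter.1 hc).1)).2⟩
    · rw [← vcomp_split hsub hd hy, ← hv]
      rw [← hv] at hy
      exact vcomp_eq_of_mem hy
    · exact fun c hc => Finset.mem_inter.2 ⟨(Finset.mem_inter.1 hc).2,
        (Finset.mem_inter.1 (hGs (Finset.mem_inter.1 hc).1)).2⟩
  · rintro ⟨H₁, H₂⟩ hp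
    simp only [Finset.mem_filter, Finset.mem_powerset, Finset.mem_product] at hp ⊢
    obtain ⟨⟨h1, hs1, ha1, hv1⟩, h2, hs2, ha2⟩ := hp
    obtain ⟨e1, e2⟩ := cap (h1.trans Finset.inter_subset_left) (h2.trans Finset.inter_subset_left)
    have hsub : H₁ ∪ H₂ ⊆ clausesOn U ∪ clausesOn (W \ U) := Finset.union_subset_union
      (h1.trans Finset.inter_subset_left) (h2.trans Finset.inter_subset_left)
    refine ⟨⟨?_, isSym_split hsub (by rwa [e1]) (by rwa [e2]), ?_⟩, ?_⟩
    · refine Finset.union_subset (h1.trans ?_) (h2.trans ?_)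
      · exact Finset.inter_subset_inter_right (clausesOn_mono hUW)
      · exact Finset.inter_subset_inter_right (clausesOn_mono Finset.sdiff_subset)
    · rw [← hUn]
      exact admissibleOn_split hsub hd (by rwa [e1]) (by rwa [e2])
    · rw [vcomp_split hsub hd hxU, e1, hv1 x hxU]
  · intro G hG
    simp only [Finset.mem_filter, Finset.mem_powerset] at hG
    obtain ⟨⟨hGs, hsym, hadm⟩, hv⟩ := hG
    have hsub := subset_clausesOn_of_isSym (hGs.trans Finset.inter_subset_left) hsym x
    rw [hv] at hsub
    simp only [← Finset.inter_union_distrib_left]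
    exact Finset.inter_eq_left.2 hsub
  · rintro ⟨H₁, H₂⟩ hp
    simp only [Finset.mem_filter, Finset.mem_powerset, Finset.mem_product] at hp
    obtain ⟨e1, e2⟩ := cap (hp.1.1.trans Finset.inter_subset_left)
      (hp.2.1.trans Finset.inter_subset_left)
    exact Prod.ext e1 e2
  · intro G hG
    simp only [Finset.mem_filter, Finset.mem_powerset] at hG
    obtain ⟨⟨hGs, hsym, hadm⟩, hv⟩ := hG
    have hsub := subset_clausesOn_of_isSym (hGs.trans Finset.inter_subset_left) hsym x
    rw [hv] at hsub
    have hsub' : G ⊆ clausesOn (W \ U) ∪ clausesOn U := by rwa [Finset.union_comm]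
    have hcard : G.card = (G ∩ clausesOn U).card + (G ∩ clausesOn (W \ U)).card := by
      rw [← Finset.card_union_of_disjoint, ← Finset.inter_union_distrib_left,
        Finset.inter_eq_left.2 hsub]
      exact (clausesOn_disjoint hd).mono Finset.inter_subset_right Finset.inter_subset_right
    -- The classes are `U` itself and the classes of the remaining variables, so the product of
    -- signs loses exactly one factor.
    have himg : W.image (vcomp G) = insert U ((W \ U).image (vcomp G)) := by
      conv_lhs => rw [← hUn]
      rw [Finset.image_union, Finset.insert_eq]
      congr 1
      refine Finset.eq_singleton_iff_unique_mem.2 ⟨Finset.mem_image.2 ⟨x, hxU, hv⟩, ?_⟩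
      intro U' hU'
      obtain ⟨y, hy, rfl⟩ := Finset.mem_image.1 hU'
      rw [← hv] at hy ⊢
      exact vcomp_eq_of_mem hy
    have hnot : U ∉ (W \ U).image (vcomp G) := by
      intro h
      obtain ⟨y, hy, hyU⟩ := Finset.mem_image.1 h
      exact (Finset.mem_sdiff.1 hy).2 (hyU ▸ self_mem_vcomp G y)
    rw [himg, Finset.prod_insert hnot, hcard, pow_add, compSign_split hsub hd subset_rfl,
      image_vcomp_split hsub' hd.symm]
    have hprod : ∏ U' ∈ (W \ U).image (vcomp (G ∩ clausesOn (W \ U))), compSign G U' =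
        ∏ U' ∈ (W \ U).image (vcomp (G ∩ clausesOn (W \ U))),
          compSign (G ∩ clausesOn (W \ U)) U' := by
      refine Finset.prod_congr rfl fun U' hU' => ?_
      obtain ⟨y, hy, rfl⟩ := Finset.mem_image.1 hU'
      exact compSign_split hsub' hd.symm (vcomp_subset Finset.inter_subset_right hy)
    rw [hprod]
    ring

/-- The exponential formula for digraphs with isolated components. -/
lemma isolatedSum_eq_expCoeff (K : Finset (Sym2 (Literal n))) (a : ℕ → PowerSeries ℚ)
    (h0 : a 0 = 0)
    (ha : ∀ U ⊆ W, U.Nonempty → atomSum S T K U = a U.card) :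
    isolatedSum S T K W = expCoeff a W.card := by
  refine eq_expCoeff_card a h0 (isolatedSum S T K) W (isolatedSum_empty S T K) ?_ W subset_rfl
  intro W' hW' x hx
  rw [isolatedSum_eq_sum_atomSum K hx]
  refine Finset.sum_congr rfl fun U hU => ?_
  simp only [Finset.mem_filter, Finset.mem_powerset] at hU
  rw [ha U (hU.1.trans hW') ⟨x, hU.2⟩]

end

/-! ### Unions of source components -/

/-- `A` is a consistent union of source components. -/
def IsSourceUnion (G : Finset (Sym2 (Literal n))) (A : Finset (Literal n)) : Prop :=
  Consistent A ∧ (∀ u v, Impl G u v → v ∈ A → u ∈ A) ∧ ∀ u ∈ A, ∀ v ∈ A, Rch G u v → Rch G v u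

/-- The number of components that make up a union of source components. -/
noncomputable def numComps (G : Finset (Sym2 (Literal n))) (A : Finset (Literal n)) : ℕ :=
  ((A.image Prod.fst).image (vcomp G)).card

section

variable {G : Finset (Sym2 (Literal n))} {A : Finset (Literal n)}

lemma IsSourceUnion.mem_of_rch (hA : IsSourceUnion G A) {u v : Literal n} (h : Rch G u v)
    (hv : v ∈ A) : u ∈ A := by
  induction h with
  | refl => exact hv
  | tail _ h ih => exact ih (hA.2.1 _ _ h hv)

lemma IsSourceUnion.comp_subset (hA : IsSourceUnion G A) {u : Literal n} (hu : u ∈ A) :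
    comp G u ⊆ A := fun _ hv => hA.mem_of_rch (mem_comp.1 hv).2 hu

lemma mem_comp_or_of_mem_vcomp {u v : Literal n} (h : v.1 ∈ vcomp G u.1) :
    v ∈ comp G u ∨ v.neg ∈ comp G u := by
  rw [← image_fst_comp] at h
  obtain ⟨w, hw, hwv⟩ := Finset.mem_image.1 h
  rcases Literal.eq_or_eq_neg hwv with rfl | rfl
  · exact .inl hw
  · exact .inr hw

lemma consistent_comp_congr {u v : Literal n} (h : v.1 ∈ vcomp G u.1) :
    Consistent (comp G v) ↔ Consistent (comp G u) := by
  rcases mem_comp_or_of_mem_vcomp h with h | h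
  · rw [comp_eq_of_mem h]
  · rw [← comp_eq_of_mem h, consistent_comp_neg]

/-- Adding or removing a source component pairs off unions of opposite signs. -/
lemma sum_toggle_eq_zero {a : Literal n} (ha : ∀ b, Rch G b a → Rch G a b)
    (hac : Consistent (comp G a)) (P : Finset (Literal n) → Prop)
    (hP : ∀ A, Disjoint A (comp G a) → (P (A ∪ comp G a) ↔ P A))
    (F : Finset (Finset (Literal n)))
    (hF : ∀ A, A ∈ F ↔ IsSourceUnion G A ∧ a.neg ∉ A ∧ P A) :
    ∑ A ∈ F, (-1 : PowerSeries ℚ) ^ numComps G A = 0 := by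
  have hdisj : ∀ A, IsSourceUnion G A → a ∉ A → Disjoint A (comp G a) := fun A hA haA =>
    Finset.disjoint_left.2 fun c hc hca => haA (hA.mem_of_rch (mem_comp.1 hca).1 hc)
  have hnegmem : a.neg ∉ comp G a := consistent_comp_iff.1 hac
  have hadd : ∀ A, IsSourceUnion G A → a.neg ∉ A → a ∉ A → IsSourceUnion G (A ∪ comp G a) := by
    intro A hA hn haA
    -- Since `c` reaches `a`, `a.neg` reaches `c.neg`, and `A` is closed under predecessors.
    have hcn : ∀ c ∈ comp G a, c.neg ∉ A := fun c hc hcA =>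
      hn (hA.mem_of_rch (rch_neg (mem_comp.1 hc).2) hcA)
    refine ⟨?_, ?_, ?_⟩
    · intro l hl hl'
      rcases Finset.mem_union.1 hl with h | h <;> rcases Finset.mem_union.1 hl' with h' | h'
      · exact hA.1 _ h h'
      · exact hcn _ h' (by rwa [Literal.neg_neg])
      · exact hcn _ h h'
      · exact hac _ h h'
    · intro u v huv hv
      rcases Finset.mem_union.1 hv with h | h
      · exact Finset.mem_union_left _ (hA.2.1 _ _ huv h)
      · have := (mem_comp.1 h).2.head huv
        exact Finset.mem_union_right _ (mem_comp.2 ⟨ha _ this, this⟩)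
    · intro u hu v hv huv
      rcases Finset.mem_union.1 hu with h | h <;> rcases Finset.mem_union.1 hv with h' | h'
      · exact hA.2.2 _ h _ h' huv
      · have := huv.trans (mem_comp.1 h').2
        exact (mem_comp.1 h').2.trans (ha _ this)
      · exact absurd (hA.mem_of_rch ((mem_comp.1 h).1.trans huv) h') haA
      · exact (mem_comp.1 h').2.trans (mem_comp.1 h).1
  -- `numComps` counts classes of variables; `a.neg ∉ A` ensures that the class of `a` is not
  -- already counted through the negated component.
  have hnum : ∀ A, IsSourceUnion G A → a.neg ∉ A → a ∉ A →
      numComps G (A ∪ comp G a) = numComps G A + 1 := by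
    intro A hA hn haA
    have h1 : ((A ∪ comp G a).image Prod.fst).image (vcomp G) =
        insert (vcomp G a.1) ((A.image Prod.fst).image (vcomp G)) := by
      rw [Finset.image_union, Finset.image_union, Finset.union_comm, Finset.insert_eq,
        image_fst_comp]
      congr 1
      refine Finset.eq_singleton_iff_unique_mem.2
        ⟨Finset.mem_image.2 ⟨_, self_mem_vcomp _ _, rfl⟩, ?_⟩
      intro U hU
      obtain ⟨y, hy, rfl⟩ := Finset.mem_image.1 hU
      exact vcomp_eq_of_mem hy
    rw [numComps, h1, Finset.card_insert_of_notMem, numComps]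
    intro h
    obtain ⟨y, hy, hy2⟩ := Finset.mem_image.1 h
    obtain ⟨l, hl, rfl⟩ := Finset.mem_image.1 hy
    have : a.1 ∈ vcomp G l.1 := by rw [hy2]; exact self_mem_vcomp _ _
    rcases mem_comp_or_of_mem_vcomp this with h | h
    · exact haA (hA.comp_subset hl h)
    · exact hn (hA.comp_subset hl h)
  have hrem : ∀ A, IsSourceUnion G A → a.neg ∉ A → a ∈ A → IsSourceUnion G (A \ comp G a) := by
    intro A hA hn haA
    refine ⟨fun l hl hl' => hA.1 l (Finset.sdiff_subset hl) (Finset.sdiff_subset hl'), ?_,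
      fun u hu v hv => hA.2.2 u (Finset.sdiff_subset hu) v (Finset.sdiff_subset hv)⟩
    intro u v huv hv
    have hvA := Finset.sdiff_subset hv
    have huA := hA.2.1 _ _ huv hvA
    refine Finset.mem_sdiff.2 ⟨huA, fun hu => (Finset.mem_sdiff.1 hv).2 ?_⟩
    have := hA.2.2 _ huA _ hvA (.single huv)
    exact mem_comp.2 ⟨(mem_comp.1 hu).1.tail huv, this.trans (mem_comp.1 hu).2⟩
  -- Toggling the component of `a` changes the number of components by one, hence reverses the sign.
  refine Finset.sum_involution
    (fun A _ => if a ∈ A then A \ comp G a else A ∪ comp G a) ?_ ?_ ?_ ?_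
  · intro A hA
    rw [hF] at hA
    by_cases haA : a ∈ A
    · rw [if_pos haA]
      have := hnum _ (hrem A hA.1 hA.2.1 haA) (fun h => hA.2.1 (Finset.sdiff_subset h))
        (fun h => (Finset.mem_sdiff.1 h).2 (self_mem_comp _ _))
      rw [Finset.sdiff_union_of_subset (hA.1.comp_subset haA)] at this
      rw [this, pow_succ]; ring
    · rw [if_neg haA, hnum A hA.1 hA.2.1 haA, pow_succ]; ring
  · intro A hA _
    by_cases haA : a ∈ A
    · rw [if_pos haA]
      intro h
      rw [← h] at haA
      exact (Finset.mem_sdiff.1 haA).2 (self_mem_comp _ _)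
    · rw [if_neg haA]
      intro h
      exact haA (h ▸ Finset.mem_union_right _ (self_mem_comp _ _))
  · intro A hA
    rw [hF] at hA ⊢
    by_cases haA : a ∈ A
    · rw [if_pos haA]
      refine ⟨hrem A hA.1 hA.2.1 haA, fun h => hA.2.1 (Finset.sdiff_subset h), ?_⟩
      rw [← hP _ Finset.sdiff_disjoint, Finset.sdiff_union_of_subset (hA.1.comp_subset haA)]
      exact hA.2.2
    · rw [if_neg haA]
      refine ⟨hadd A hA.1 hA.2.1 haA, fun h => ?_, (hP _ (hdisj A hA.1 haA)).2 hA.2.2⟩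
      exact (Finset.mem_union.1 h).elim hA.2.1 hnegmem
  · intro A hA
    rw [hF] at hA
    by_cases haA : a ∈ A
    · have : a ∉ A \ comp G a := fun h => (Finset.mem_sdiff.1 h).2 (self_mem_comp _ _)
      simp only [if_pos haA, if_neg this]
      exact Finset.sdiff_union_of_subset (hA.1.comp_subset haA)
    · have : a ∈ A ∪ comp G a := Finset.mem_union_right _ (self_mem_comp _ _)
      simp only [if_neg haA, if_pos this]
      exact Finset.union_sdiff_cancel_right (hdisj A hA.1 haA)

/-- A digraph with an arc between two components has an ordinary source component that is not
isolated. -/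
lemma exists_source (hG : ¬ IsSym G) :
    ∃ a v, (∀ b, Rch G b a → Rch G a b) ∧ Rch G a v ∧ ¬ Rch G v a := by
  simp only [IsSym, not_forall] at hG
  obtain ⟨u, v, huv, hvu⟩ := hG
  -- A literal with the fewest predecessors, among those that reach `u`, lies in a source component.
  obtain ⟨a, ha, hmin⟩ := Finset.exists_min_image (Finset.univ.filter fun b => Rch G b u)
    (fun a => (Finset.univ.filter fun b => Rch G b a).card)
    ⟨u, by simp only [Finset.mem_filter, Finset.mem_univ, true_and]; exact .refl⟩
  simp only [Finset.mem_filter, Finset.mem_univ, true_and] at ha hmin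
  refine ⟨a, v, fun b hb => ?_, ha.trans huv, fun h => hvu (h.trans ha)⟩
  have hsub : (Finset.univ.filter fun c => Rch G c b) ⊆ Finset.univ.filter fun c => Rch G c a := by
    intro c
    simp only [Finset.mem_filter, Finset.mem_univ, true_and]
    exact fun h => h.trans hb
  have heq := Finset.eq_of_subset_of_card_le hsub (hmin b (hb.trans ha))
  have : a ∈ Finset.univ.filter fun c => Rch G c b := by
    rw [heq]
    simp only [Finset.mem_filter, Finset.mem_univ, true_and]
    exact .refl
  simpa using this

/-- The source literal `a` reaches some `v` that does not reach it back. This makes its component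
ordinary, and it also keeps `a.neg` out of every source union, so the component can be toggled
freely. -/
lemma sum_sourceUnion_of_not_isSym (hG : ¬ IsSym G) :
    ∑ A : Finset (Literal n) with IsSourceUnion G A, (-1 : PowerSeries ℚ) ^ numComps G A = 0 := by
  obtain ⟨a, v, ha, hav, hva⟩ := exists_source hG
  -- Otherwise `v.neg` reaches `a.neg`, hence `a`; as `a` is a source it reaches `v.neg`, so `v`
  -- reaches `a.neg` and then `a`.
  have hc : Consistent (comp G a) := by
    rw [consistent_comp_iff]
    intro h
    have h1 := (mem_comp.1 h).2
    have h2 := ha _ ((rch_neg hav).trans h1)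
    have h3 := rch_neg h2
    rw [Literal.neg_neg] at h3
    exact hva (h3.trans h1)
  refine sum_toggle_eq_zero ha hc (fun _ => True) (fun _ _ => Iff.rfl) _ fun A => ?_
  simp only [Finset.mem_filter, Finset.mem_univ, true_and, and_true]
  -- If `a.neg ∈ A`, its predecessor `v.neg` is in `A` too, so `a.neg` must reach `v.neg` back, that
  -- is, `v` reaches `a`.
  refine ⟨fun hA => ⟨hA, fun hn => ?_⟩, fun h => h.1⟩
  have h1 := rch_neg hav
  have h2 := rch_neg (hA.2.2 _ (hA.mem_of_rch h1 hn) _ hn h1)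
  rw [Literal.neg_neg, Literal.neg_neg] at h2
  exact hva h2

/-- A representative of the variables of a component. -/
noncomputable def rep (G : Finset (Sym2 (Literal n))) (x : Fin n) : Fin n :=
  (vcomp G x).min' ⟨x, self_mem_vcomp G x⟩

lemma rep_mem (G : Finset (Sym2 (Literal n))) (x : Fin n) : rep G x ∈ vcomp G x :=
  Finset.min'_mem _ _

lemma rep_eq {x y : Fin n} (h : vcomp G x = vcomp G y) : rep G x = rep G y := by
  simp only [rep, h]

/-- For each ordinary pair, the choices "neither component" and "the component of the positive
representative" cancel, so only the negative choice survives. The pairs are treated one at a time by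
induction on `Z`. -/
lemma sum_sourceUnion_eq_sum_neg (hG : IsSym G) (Z : Finset (Fin n))
    (hZ : ∀ x ∈ Z, Consistent (comp G (x, true))) :
    ∑ A : Finset (Literal n) with IsSourceUnion G A, (-1 : PowerSeries ℚ) ^ numComps G A =
      ∑ A : Finset (Literal n) with IsSourceUnion G A ∧ ∀ x ∈ Z, (rep G x, false) ∈ A,
        (-1 : PowerSeries ℚ) ^ numComps G A := by
  induction Z using Finset.induction_on with
  | empty => simp
  | insert x Z hx ih =>
    rw [ih fun y hy => hZ y (Finset.mem_insert_of_mem hy)]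
    -- If the class of `x` is already represented in `Z`, its condition is already imposed.
    by_cases hr : ∃ z ∈ Z, rep G z = rep G x
    · obtain ⟨z, hz, hzx⟩ := hr
      refine Finset.sum_congr (Finset.filter_congr fun A _ => and_congr_right fun _ => ?_)
        fun _ _ => rfl
      rw [Finset.forall_mem_insert, ← hzx]
      exact ⟨fun h => ⟨h z hz, h⟩, fun h => h.2⟩
    · push Not at hr
      rw [← Finset.sum_filter_add_sum_filter_not _ fun A => ((rep G x, false) : Literal n) ∈ A]
      have h0 := sum_toggle_eq_zero (G := G) (a := (rep G x, true)) (fun b hb => hG _ _ hb)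
        ((consistent_comp_congr (u := (x, true)) (v := (rep G x, true)) (rep_mem G x)).2
          (hZ x (Finset.mem_insert_self _ _)))
        (fun A => ∀ z ∈ Z, (rep G z, false) ∈ A) (fun A _ => ?_)
        ((Finset.univ.filter fun A : Finset (Literal n) => IsSourceUnion G A ∧
          ∀ x ∈ Z, (rep G x, false) ∈ A).filter fun A => (rep G x, false) ∉ A) (fun A => ?_)
      · rw [h0, add_zero, Finset.filter_filter]
        refine Finset.sum_congr (Finset.filter_congr fun A _ => ?_) fun _ _ => rfl
        rw [Finset.forall_mem_insert]
        exact ⟨fun h => ⟨h.1.1, h.2, h.1.2⟩, fun h => ⟨⟨h.1, h.2.2⟩, h.2.1⟩⟩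
      -- Toggling the component of `(rep G x, true)` does not affect the conditions at other
      -- representatives, which lie in other classes.
      · refine forall₂_congr fun z hz => ?_
        rw [Finset.mem_union, or_iff_left]
        intro h
        have h1 : rep G z ∈ vcomp G (rep G x) := mem_vcomp.2 ⟨_, h⟩
        rw [vcomp_eq_of_mem (rep_mem G x)] at h1
        refine hr z hz (rep_eq ?_)
        rw [← vcomp_eq_of_mem h1, vcomp_eq_of_mem (rep_mem G z)]
      · simp only [Finset.mem_filter, Finset.mem_univ, true_and]
        exact ⟨fun h => ⟨h.1.1, h.2, h.1.2⟩, fun h => ⟨⟨h.1, h.2.2⟩, h.2.1⟩⟩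

/-- After the cancellation a single source union `A₀` is left: the negative component of every
ordinary pair. Its sign is the product of `-1` over these pairs, and contradictory classes
contribute `1`. -/
lemma sum_sourceUnion_of_isSym (hG : IsSym G) :
    ∑ A : Finset (Literal n) with IsSourceUnion G A, (-1 : PowerSeries ℚ) ^ numComps G A =
      ∏ U ∈ Finset.univ.image (vcomp G), compSign G U := by
  obtain ⟨Z, hZ⟩ : ∃ Z : Finset (Fin n), Z = Finset.univ.filter fun x =>
    Consistent (comp G (x, true)) := ⟨_, rfl⟩
  have hZm : ∀ l : Literal n, l.1 ∈ Z ↔ Consistent (comp G l) := fun l => by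
    simp only [hZ, Finset.mem_filter, Finset.mem_univ, true_and]
    exact consistent_comp_congr (self_mem_vcomp G l.1)
  rw [sum_sourceUnion_eq_sum_neg hG Z fun x hx => (hZm (x, true)).1 hx]
  obtain ⟨A₀, hA₀⟩ : ∃ A₀ : Finset (Literal n), A₀ = Finset.univ.filter fun l =>
    l.1 ∈ Z ∧ l ∈ comp G (rep G l.1, false) := ⟨_, rfl⟩
  have hmem : ∀ l, l ∈ A₀ ↔ l.1 ∈ Z ∧ l ∈ comp G (rep G l.1, false) := fun l => by simp [hA₀]
  have hclosed : ∀ u v, Impl G u v → (u ∈ A₀ ↔ v ∈ A₀) := by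
    intro u v huv
    have h1 : v ∈ comp G u := hG.mem_comp.2 (.single huv)
    rw [hmem, hmem, hZm, hZm, comp_eq_of_mem h1, rep_eq (hG.vcomp_eq huv)]
    refine and_congr_right fun _ => ?_
    constructor
    · intro h; rw [← comp_eq_of_mem h]; exact h1
    · intro h; rw [← comp_eq_of_mem h, comp_eq_of_mem h1]; exact self_mem_comp _ _
  have hval : IsSourceUnion G A₀ := by
    refine ⟨fun l hl hl' => ?_, fun u v huv hv => (hclosed u v huv).2 hv,
      fun u _ v _ huv => hG _ _ huv⟩
    rw [hmem] at hl hl'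
    have h1 := (hZm l).1 hl.1
    rw [comp_eq_of_mem hl.2] at h1
    exact h1 _ hl.2 hl'.2
  have hrepZ : ∀ x ∈ Z, rep G x ∈ Z ∧ rep G (rep G x) = rep G x := fun x hx =>
    ⟨(hZm (rep G x, true)).2 ((consistent_comp_congr (u := (x, true)) (rep_mem G x)).2
      ((hZm (x, true)).1 hx)), rep_eq (vcomp_eq_of_mem (rep_mem G x))⟩
  -- A source union contains only ordinary components, and consistency forbids the positive member
  -- of a pair once the negative one is present.
  have huniq : (Finset.univ.filter fun A : Finset (Literal n) => IsSourceUnion G A ∧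
      ∀ x ∈ Z, (rep G x, false) ∈ A) = {A₀} := by
    refine Finset.eq_singleton_iff_unique_mem.2 ⟨?_, ?_⟩
    · simp only [Finset.mem_filter, Finset.mem_univ, true_and]
      refine ⟨hval, fun x hx => (hmem _).2 ⟨(hrepZ x hx).1, ?_⟩⟩
      rw [(hrepZ x hx).2]
      exact self_mem_comp _ _
    · intro A hA
      simp only [Finset.mem_filter, Finset.mem_univ, true_and] at hA
      ext l
      rw [hmem]
      constructor
      · intro hl
        have hlZ : l.1 ∈ Z := (hZm l).2 fun k hk hk' =>
          hA.1.1 k (hA.1.comp_subset hl hk) (hA.1.comp_subset hl hk')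
        have hr := hA.2 _ hlZ
        refine ⟨hlZ, ?_⟩
        have h1 : l.1 ∈ vcomp G (rep G l.1) := by
          rw [vcomp_eq_of_mem (rep_mem G l.1)]; exact self_mem_vcomp _ _
        rcases mem_comp_or_of_mem_vcomp (u := (rep G l.1, false)) h1 with h | h
        · exact h
        · exact absurd (hA.1.comp_subset hr h) (hA.1.1 l hl)
      · rintro ⟨hlZ, hl⟩
        exact hA.1.comp_subset (hA.2 _ hlZ) hl
  rw [huniq, Finset.sum_singleton]
  have hvars : A₀.image Prod.fst = Z := by
    ext x
    simp only [Finset.mem_image]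
    constructor
    · rintro ⟨l, hl, rfl⟩
      exact ((hmem l).1 hl).1
    · intro hx
      have h1 : x ∈ vcomp G (rep G x) := by
        rw [vcomp_eq_of_mem (rep_mem G x)]; exact self_mem_vcomp _ _
      rcases mem_comp_or_of_mem_vcomp (v := (x, true)) (u := (rep G x, false)) h1 with h | h
      · exact ⟨(x, true), (hmem (x, true)).2 ⟨hx, h⟩, rfl⟩
      · exact ⟨(x, false), (hmem (x, false)).2 ⟨hx, h⟩, rfl⟩
  rw [numComps, hvars]
  have hsign : ∀ x, compSign G (vcomp G x) = if x ∈ Z then -1 else 1 := by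
    intro x
    unfold compSign
    congr 1
    refine propext ⟨fun h => (hZm (x, true)).2 (h x (self_mem_vcomp _ _)), fun h y hy => ?_⟩
    have h' : Consistent (comp G (x, true)) := (hZm (x, true)).1 h
    exact (consistent_comp_congr (u := (x, true)) (v := (y, true)) hy).2 h'
  have hsub : Z.image (vcomp G) ⊆ Finset.univ.image (vcomp G) :=
    Finset.image_subset_image (Finset.subset_univ _)
  have h1 : ∏ U ∈ Z.image (vcomp G), compSign G U = ∏ U ∈ Finset.univ.image (vcomp G),
      compSign G U := by
    refine Finset.prod_subset hsub fun U hU hU' => ?_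
    obtain ⟨x, _, rfl⟩ := Finset.mem_image.1 hU
    rw [hsign, if_neg]
    exact fun hx => hU' (Finset.mem_image_of_mem _ hx)
  rw [← h1]
  symm
  refine Finset.prod_eq_pow_card fun U hU => ?_
  obtain ⟨x, hx, rfl⟩ := Finset.mem_image.1 hU
  rw [hsign, if_pos hx]

end

/-! ### Splitting off a union of source components -/

/-- The variables of a set of literals. -/
noncomputable abbrev vars (A : Finset (Literal n)) : Finset (Fin n) := A.image Prod.fst

/-- The clauses that encode the arcs between literals of `A`. -/
noncomputable def clausesIn (A : Finset (Literal n)) : Finset (Sym2 (Literal n)) :=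
  (clausesOn Finset.univ).filter fun c => ∃ k l : Literal n, c = s(k, l) ∧ k.neg ∈ A ∧ l ∈ A

/-- The clauses that encode the arcs that leave `A`, and the negations of these arcs. -/
noncomputable def clausesOut (A : Finset (Literal n)) : Finset (Sym2 (Literal n)) :=
  (clausesOn Finset.univ).filter fun c => (∀ l ∈ c, l ∉ A) ∧ ∃ l ∈ c, l.neg ∈ A

/-- The weight of the admissible implication digraphs with variables in `W`. -/
noncomputable def cnfSum (S : DigraphFamily) (T : ImplicationFamily) (W : Finset (Fin n)) :
    PowerSeries ℚ :=
  ∑ G ∈ (clausesOn W).powerset with AdmissibleOn S T G W, X ^ G.card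

section

variable {S : DigraphFamily} {T : ImplicationFamily} {G : Finset (Sym2 (Literal n))}
  {A : Finset (Literal n)}

lemma mem_clausesIn {k l : Literal n} :
    s(k, l) ∈ clausesIn A ↔ k.1 ≠ l.1 ∧ (k.neg ∈ A ∧ l ∈ A ∨ l.neg ∈ A ∧ k ∈ A) := by
  simp only [clausesIn, Finset.mem_filter, mem_clausesOn, Finset.mem_univ, true_and]
  refine and_congr_right fun _ => ?_
  constructor
  · rintro ⟨a, b, h, ha, hb⟩
    rcases Sym2.eq_iff.1 h with ⟨rfl, rfl⟩ | ⟨rfl, rfl⟩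
    · exact .inl ⟨ha, hb⟩
    · exact .inr ⟨ha, hb⟩
  · rintro (h | h)
    · exact ⟨k, l, rfl, h⟩
    · exact ⟨l, k, Sym2.eq_swap, h⟩

lemma mem_clausesOut {k l : Literal n} :
    s(k, l) ∈ clausesOut A ↔ k.1 ≠ l.1 ∧ (k ∉ A ∧ l ∉ A) ∧ (k.neg ∈ A ∨ l.neg ∈ A) := by
  simp only [clausesOut, Finset.mem_filter, mem_clausesOn, Finset.mem_univ, true_and, Sym2.mem_iff,
    forall_eq_or_imp, exists_eq_or_imp, forall_eq, exists_eq_left]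

lemma mem_vars {l : Literal n} : l.1 ∈ vars A ↔ l ∈ A ∨ l.neg ∈ A := by
  rw [Finset.mem_image]
  constructor
  · rintro ⟨k, hk, hkl⟩
    rcases Literal.eq_or_eq_neg hkl with rfl | rfl
    · exact .inl hk
    · exact .inr hk
  · rintro (h | h)
    · exact ⟨_, h, rfl⟩
    · exact ⟨_, h, rfl⟩

lemma clausesIn_subset : clausesIn A ⊆ clausesOn (vars A) := by
  intro c
  induction c with | _ k l =>
  rw [mem_clausesIn, mem_clausesOn, mem_vars, mem_vars]
  tauto

lemma clausesIn_disjoint_clausesOut :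
    Disjoint (clausesIn A) (clausesOut A) := by
  rw [Finset.disjoint_left]
  intro c
  induction c with | _ k l =>
  rw [mem_clausesIn, mem_clausesOut]
  tauto

lemma clausesIn_disjoint_clausesOn : Disjoint (clausesIn A) (clausesOn (Finset.univ \ vars A)) :=
  (clausesOn_disjoint Finset.disjoint_sdiff).mono_left clausesIn_subset

lemma clausesOut_disjoint_clausesOn :
    Disjoint (clausesOut A) (clausesOn (Finset.univ \ vars A)) := by
  rw [Finset.disjoint_left]
  intro c
  induction c with | _ k l =>
  rw [mem_clausesOut, mem_clausesOn, Finset.mem_sdiff, Finset.mem_sdiff, mem_vars, mem_vars]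
  tauto

/-- The clauses without an arc that enters `A`. -/
noncomputable def clausesNotInto (A : Finset (Literal n)) : Finset (Sym2 (Literal n)) :=
  clausesOut A ∪ (clausesIn A ∪ clausesOn (Finset.univ \ vars A))

lemma clausesNotInto_subset : clausesNotInto A ⊆ clausesOn Finset.univ :=
  Finset.union_subset (Finset.filter_subset _ _)
    (Finset.union_subset (Finset.filter_subset _ _) (clausesOn_mono (Finset.subset_univ _)))

lemma mem_clausesNotInto (hA : Consistent A) {k l : Literal n} (hkl : k.1 ≠ l.1) :
    s(k, l) ∈ clausesNotInto A ↔ (k ∈ A → l.neg ∈ A) ∧ (l ∈ A → k.neg ∈ A) := by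
  simp only [clausesNotInto, Finset.mem_union, mem_clausesOut, mem_clausesIn, mem_clausesOn,
    Finset.mem_sdiff, Finset.mem_univ, true_and, mem_vars]
  have hk := hA k
  have hl := hA l
  tauto

/-- Being closed under predecessors is a condition on each clause separately; this is what makes the
clauses independent for fixed `A`. -/
lemma forall_impl_mem_iff (hA : Consistent A) (hG : G ⊆ clausesOn Finset.univ) :
    (∀ u v, Impl G u v → v ∈ A → u ∈ A) ↔ G ⊆ clausesNotInto A := by
  constructor
  · intro h c
    induction c with | _ k l =>
    intro hc
    have h3 := (mem_clausesOn.1 (hG hc)).2.2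
    rw [mem_clausesNotInto hA h3]
    refine ⟨fun hk => h l.neg k ?_ hk, fun hl => h k.neg l ?_ hl⟩
    · rwa [Impl, Literal.neg_neg, Sym2.eq_swap]
    · rwa [Impl, Literal.neg_neg]
  · intro h u v huv hv
    have h3 := (mem_clausesOn.1 (hG huv)).2.2
    have := ((mem_clausesNotInto hA h3).1 (h huv)).2 hv
    rwa [Literal.neg_neg] at this

lemma impl_inter_clausesIn (hG : G ⊆ clausesNotInto A)
    {u v : Literal n} (hu : u ∈ A) (hv : v ∈ A)
    (h : Impl G u v) :
    Impl (G ∩ clausesIn A) u v :=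
  Finset.mem_inter.2 ⟨h, mem_clausesIn.2
    ⟨(mem_clausesOn.1 (clausesNotInto_subset (hG h))).2.2, .inl ⟨by simpa using hu, hv⟩⟩⟩

lemma impl_inter_clausesOn (hG : G ⊆ clausesNotInto A)
    {u v : Literal n} (hu : u.1 ∉ vars A) (hv : v.1 ∉ vars A)
    (h : Impl G u v) : Impl (G ∩ clausesOn (Finset.univ \ vars A)) u v :=
  Finset.mem_inter.2 ⟨h, mem_clausesOn.2 ⟨Finset.mem_sdiff.2 ⟨Finset.mem_univ _, hu⟩,
    Finset.mem_sdiff.2 ⟨Finset.mem_univ _, hv⟩,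
    (mem_clausesOn.1 (clausesNotInto_subset (hG h))).2.2⟩⟩

section

lemma mem_of_rch_of_subset (hA : Consistent A) (hG : G ⊆ clausesNotInto A)
    {u v : Literal n} (h : Rch G u v) (hv : v ∈ A) : u ∈ A := by
  induction h with
  | refl => exact hv
  | tail _ h ih =>
    exact ih ((forall_impl_mem_iff hA (hG.trans clausesNotInto_subset)).2 hG _ _ h hv)

lemma rch_clausesIn (hA : Consistent A) (hG : G ⊆ clausesNotInto A)
    {u v : Literal n} (hu : u ∈ A) (hv : v ∈ A) :
    Rch G u v ↔ Rch (G ∩ clausesIn A) u v :=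
  rch_iff_of_convex (P := (· ∈ A)) Finset.inter_subset_left
    (fun _ _ h1 h2 h => impl_inter_clausesIn hG h1 h2 h)
    (fun _ _ _ _ h2 _ h4 => mem_of_rch_of_subset hA hG h4 h2) hu hv

lemma comp_clausesIn (hA : Consistent A) (hG : G ⊆ clausesNotInto A)
    {u : Literal n} (hu : u ∈ A) : comp G u = comp (G ∩ clausesIn A) u :=
  comp_eq_of_convex (P := (· ∈ A)) Finset.inter_subset_left
    (fun _ _ h1 h2 h => impl_inter_clausesIn hG h1 h2 h)
    (fun _ _ _ _ h2 _ h4 => mem_of_rch_of_subset hA hG h4 h2) hu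

lemma comp_subset_of_subset (hA : Consistent A) (hG : G ⊆ clausesNotInto A)
    {u : Literal n} (hu : u ∈ A) : comp G u ⊆ A :=
  fun _ hv => mem_of_rch_of_subset hA hG (mem_comp.1 hv).2 hu

/-- A path cannot visit `A` unless it starts there, nor the negation of `A` unless it ends there. -/
lemma convex_compl_vars (hA : Consistent A) (hG : G ⊆ clausesNotInto A)
    {u v w : Literal n} (hu : u.1 ∉ vars A) (hw : w.1 ∉ vars A)
    (huv : Rch G u v) (hvw : Rch G v w) : v.1 ∉ vars A := by
  rw [mem_vars] at *
  rintro (h | h)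
  · exact hu (.inl (mem_of_rch_of_subset hA hG huv h))
  · exact hw (.inr (mem_of_rch_of_subset hA hG (rch_neg hvw) h))

lemma comp_clausesOn (hA : Consistent A) (hG : G ⊆ clausesNotInto A)
    {u : Literal n} (hu : u.1 ∉ vars A) :
    comp G u = comp (G ∩ clausesOn (Finset.univ \ vars A)) u :=
  comp_eq_of_convex (P := fun u => u.1 ∉ vars A) Finset.inter_subset_left
    (fun _ _ h1 h2 h => impl_inter_clausesOn hG h1 h2 h)
    (fun _ _ _ h1 h2 h3 h4 => convex_compl_vars hA hG h1 h2 h3 h4) hu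

lemma admissible_clausesIn (hA : Consistent A) (hG : G ⊆ clausesNotInto A)
    {u : Literal n} (hu : u ∈ A) :
    Admissible S T G (comp G u) ↔
      Admissible S T (G ∩ clausesIn A) (comp (G ∩ clausesIn A) u) := by
  rw [← comp_clausesIn hA hG hu]
  exact admissible_congr fun v hv w hw =>
    ⟨impl_inter_clausesIn hG (comp_subset_of_subset hA hG hu hv)
      (comp_subset_of_subset hA hG hu hw),
      fun h => (Finset.mem_inter.1 h).1⟩

lemma admissible_clausesOn (hA : Consistent A) (hG : G ⊆ clausesNotInto A)
    {u : Literal n} (hu : u.1 ∉ vars A) :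
    Admissible S T G (comp G u) ↔ Admissible S T (G ∩ clausesOn (Finset.univ \ vars A))
      (comp (G ∩ clausesOn (Finset.univ \ vars A)) u) := by
  rw [← comp_clausesOn hA hG hu]
  have hm : ∀ v ∈ comp G u, v.1 ∉ vars A := fun v hv =>
    convex_compl_vars hA hG hu hu (mem_comp.1 hv).1 (mem_comp.1 hv).2
  exact admissible_congr fun v hv w hw =>
    ⟨impl_inter_clausesOn hG (hm v hv) (hm w hw), fun h => (Finset.mem_inter.1 h).1⟩

/-- Components of `G` lie in `A`, in its negation, or on the other variables. Convexity lets each be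
computed from its own group of clauses, and reversal transfers admissibility from `A` to its
negation. -/
lemma admissibleOn_univ_iff (hA : Consistent A) (hG : G ⊆ clausesNotInto A)
    (hS : IsOrdinarySCCFamily S) :
    AdmissibleOn S T G Finset.univ ↔ AdmissibleOn S T (G ∩ clausesIn A) (vars A) ∧
      AdmissibleOn S T (G ∩ clausesOn (Finset.univ \ vars A)) (Finset.univ \ vars A) := by
  constructor
  · refine fun h => ⟨fun u hu => ?_, fun u hu => ?_⟩
    · rcases mem_vars.1 hu with h' | h'
      · exact (admissible_clausesIn hA hG h').1 (h u (Finset.mem_univ _))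
      · have := admissible_comp_neg hS ((admissible_clausesIn hA hG h').1 (h _ (Finset.mem_univ _)))
        rwa [Literal.neg_neg] at this
    · exact (admissible_clausesOn hA hG (Finset.mem_sdiff.1 hu).2).1 (h u (Finset.mem_univ _))
  · rintro ⟨h1, h2⟩ u -
    by_cases hu : u.1 ∈ vars A
    · rcases mem_vars.1 hu with h' | h'
      · exact (admissible_clausesIn hA hG h').2 (h1 u hu)
      · have := admissible_comp_neg hS ((admissible_clausesIn hA hG h').2 (h1 _ hu))
        rwa [Literal.neg_neg] at this
    · exact (admissible_clausesOn hA hG hu).2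
        (h2 u (Finset.mem_sdiff.2 ⟨Finset.mem_univ _, hu⟩))

/-- Once no arc enters `A`, it only remains to ask that there be no arc between different components
inside `A`; by negation symmetry this is isolation for the clauses in `A`. -/
lemma isSourceUnion_iff (hA : Consistent A) (hG : G ⊆ clausesNotInto A) :
    IsSourceUnion G A ↔ IsSym (G ∩ clausesIn A) := by
  constructor
  · intro h
    rw [isSym_iff]
    intro u v huv
    rcases (mem_clausesIn.1 (Finset.mem_inter.1 huv).2).2 with h1 | h1
    · rw [Literal.neg_neg] at h1
      exact (rch_clausesIn hA hG h1.2 h1.1).1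
        (h.2.2 _ h1.1 _ h1.2 (.single (Finset.mem_inter.1 huv).1))
    · have h2 := (rch_clausesIn hA hG h1.2 h1.1).1
        (h.2.2 _ h1.1 _ h1.2 (.single (Impl.neg (Finset.mem_inter.1 huv).1)))
      have h3 := rch_neg h2
      rwa [Literal.neg_neg, Literal.neg_neg] at h3
  · intro h
    refine ⟨hA, (forall_impl_mem_iff hA (hG.trans clausesNotInto_subset)).2 hG, ?_⟩
    intro u hu v hv huv
    exact (rch_clausesIn hA hG hv hu).2 (h _ _ ((rch_clausesIn hA hG hu hv).1 huv))

/-- All components inside the consistent set `A` are ordinary, so every class has sign `-1`. -/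
lemma neg_one_pow_numComps (hA : Consistent A) (hG : G ⊆ clausesNotInto A) :
    (-1 : PowerSeries ℚ) ^ numComps G A =
      ∏ U ∈ (vars A).image (vcomp (G ∩ clausesIn A)), compSign (G ∩ clausesIn A) U := by
  have h1 : (vars A).image (vcomp G) = (vars A).image (vcomp (G ∩ clausesIn A)) := by
    refine Finset.image_congr fun x hx => ?_
    obtain ⟨l, hl, rfl⟩ := Finset.mem_image.1 hx
    rw [← image_fst_comp, comp_clausesIn hA hG hl, image_fst_comp]
  rw [numComps, h1]
  symm
  refine Finset.prod_eq_pow_card fun U hU => ?_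
  obtain ⟨x, hx, rfl⟩ := Finset.mem_image.1 hU
  obtain ⟨l, hl, rfl⟩ := Finset.mem_image.1 hx
  unfold compSign
  rw [if_pos]
  intro y hy
  refine (consistent_comp_congr (u := l) (v := (y, true)) hy).2 ?_
  rw [← comp_clausesIn hA hG hl]
  exact fun k hk hk' => hA k (comp_subset_of_subset hA hG hl hk)
    (comp_subset_of_subset hA hG hl hk')

end

/-! ### The double count of digraphs and source unions. -/

lemma sum_powerset_X_pow_card {α : Type*} [DecidableEq α] (K : Finset α) :
    ∑ G ∈ K.powerset, (X : PowerSeries ℚ) ^ G.card = (1 + X) ^ K.card := by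
  have := Finset.sum_pow_mul_eq_add_pow (X : PowerSeries ℚ) 1 K
  simpa [add_comm] using this

/-- The sum over the subsets of a disjoint union. -/
lemma sum_powerset_union {α R : Type*} [DecidableEq α] [CommSemiring R] {K L : Finset α}
    (h : Disjoint K L) (f g : Finset α → R) :
    ∑ G ∈ (K ∪ L).powerset, f (G ∩ K) * g (G ∩ L) =
      (∑ G ∈ K.powerset, f G) * ∑ G ∈ L.powerset, g G := by
  rw [Finset.sum_mul_sum, ← Finset.sum_product']
  have cap : ∀ {H₁ H₂ : Finset α}, H₁ ⊆ K → H₂ ⊆ L →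
      (H₁ ∪ H₂) ∩ K = H₁ ∧ (H₁ ∪ H₂) ∩ L = H₂ := by
    intro H₁ H₂ h1 h2
    constructor
    · rw [Finset.union_inter_distrib_right, Finset.inter_eq_left.2 h1,
        Finset.disjoint_iff_inter_eq_empty.1 (h.symm.mono_left h2), Finset.union_empty]
    · rw [Finset.union_inter_distrib_right, Finset.inter_eq_left.2 h2,
        Finset.disjoint_iff_inter_eq_empty.1 (h.mono_left h1), Finset.empty_union]
  refine Finset.sum_bij' (fun G _ => (G ∩ K, G ∩ L)) (fun p _ => p.1 ∪ p.2) ?_ ?_ ?_ ?_ ?_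
  · intro G _
    simp
  · rintro ⟨H₁, H₂⟩ hp
    simp only [Finset.mem_product, Finset.mem_powerset] at hp ⊢
    exact Finset.union_subset_union hp.1 hp.2
  · intro G hG
    simp only [Finset.mem_powerset] at hG
    simp only [← Finset.inter_union_distrib_left]
    exact Finset.inter_eq_left.2 hG
  · rintro ⟨H₁, H₂⟩ hp
    simp only [Finset.mem_product, Finset.mem_powerset] at hp
    exact Prod.ext (cap hp.1 hp.2).1 (cap hp.1 hp.2).2
  · intro G _
    rfl

/-- The count for fixed `A`: the clauses leaving `A` are unconstrained, and the clauses inside `A`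
and off its variables are constrained independently. -/
lemma sum_admissible_sourceUnion (hS : IsOrdinarySCCFamily S) (hA : Consistent A) :
    ∑ G ∈ (clausesOn (Finset.univ : Finset (Fin n))).powerset with
        (AdmissibleOn S T G Finset.univ ∧ IsSourceUnion G A),
      (-1 : PowerSeries ℚ) ^ numComps G A * X ^ G.card =
    (1 + X) ^ (clausesOut A).card * isolatedSum S T (clausesIn A) (vars A) *
      cnfSum S T (Finset.univ \ vars A) := by
  have hd1 : Disjoint (clausesOut A) (clausesIn A ∪ clausesOn (Finset.univ \ vars A)) :=
    Finset.disjoint_union_right.2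
      ⟨clausesIn_disjoint_clausesOut.symm, clausesOut_disjoint_clausesOn⟩
  have hd2 := clausesIn_disjoint_clausesOn (A := A)
  rw [isolatedSum, cnfSum, Finset.inter_eq_right.2 clausesIn_subset, ← sum_powerset_X_pow_card,
    mul_assoc, Finset.sum_filter (s := (clausesIn A).powerset),
    Finset.sum_filter (s := (clausesOn (Finset.univ \ vars A)).powerset),
    ← sum_powerset_union hd2, ← sum_powerset_union hd1, Finset.sum_filter]
  symm
  -- Digraphs with an arc entering `A` contribute nothing.
  refine Finset.sum_subset_zero_on_sdiff (Finset.powerset_mono.2 clausesNotInto_subset) ?_ ?_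
  · intro G hG
    rw [Finset.mem_sdiff, Finset.mem_powerset, Finset.mem_powerset] at hG
    rw [if_neg]
    exact fun h => hG.2 ((forall_impl_mem_iff hA hG.1).1 h.2.2.1)
  · intro G hG
    have hG : G ⊆ clausesNotInto A := Finset.mem_powerset.1 hG
    have e1 : G ∩ (clausesIn A ∪ clausesOn (Finset.univ \ vars A)) ∩ clausesIn A =
        G ∩ clausesIn A := by
      rw [Finset.inter_assoc, Finset.union_inter_cancel_left]
    have e2 : G ∩ (clausesIn A ∪ clausesOn (Finset.univ \ vars A)) ∩
        clausesOn (Finset.univ \ vars A) = G ∩ clausesOn (Finset.univ \ vars A) := by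
      rw [Finset.inter_assoc, Finset.union_inter_cancel_right]
    have hcard : G.card = (G ∩ clausesOut A).card + ((G ∩ clausesIn A).card +
        (G ∩ clausesOn (Finset.univ \ vars A)).card) := by
      rw [← Finset.card_union_of_disjoint (hd2.mono Finset.inter_subset_right
        Finset.inter_subset_right), ← Finset.inter_union_distrib_left,
        ← Finset.card_union_of_disjoint (hd1.mono Finset.inter_subset_right
        Finset.inter_subset_right), ← Finset.inter_union_distrib_left]
      congr 1
      exact (Finset.inter_eq_left.2 hG).symm
    rw [e1, e2, neg_one_pow_numComps hA hG, hcard, pow_add, pow_add]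
    by_cases h1 : IsSym (G ∩ clausesIn A) ∧ AdmissibleOn S T (G ∩ clausesIn A) (vars A)
    · by_cases h2 : AdmissibleOn S T (G ∩ clausesOn (Finset.univ \ vars A))
        (Finset.univ \ vars A)
      · rw [if_pos h1, if_pos h2, if_pos ⟨(admissibleOn_univ_iff hA hG hS).2 ⟨h1.2, h2⟩,
          (isSourceUnion_iff hA hG).2 h1.1⟩]
        ring
      · have hn : ¬ (AdmissibleOn S T G Finset.univ ∧ IsSourceUnion G A) :=
          fun h => h2 ((admissibleOn_univ_iff hA hG hS).1 h.1).2
        rw [if_neg h2, if_neg hn, mul_zero, mul_zero]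
    · have hn : ¬ (AdmissibleOn S T G Finset.univ ∧ IsSourceUnion G A) := fun h =>
        h1 ⟨(isSourceUnion_iff hA hG).1 h.2, ((admissibleOn_univ_iff hA hG hS).1 h.1).1⟩
      rw [if_neg h1, if_neg hn, zero_mul, mul_zero]

/-- Counting pairs of an admissible digraph and a union of source components in two ways. -/
lemma sum_consistent_eq_isolatedSum (hS : IsOrdinarySCCFamily S) :
    ∑ A : Finset (Literal n) with Consistent A,
      (1 + X) ^ (clausesOut A).card * isolatedSum S T (clausesIn A) (vars A) *
        cnfSum S T (Finset.univ \ vars A) =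
    isolatedSum S T Finset.univ (Finset.univ : Finset (Fin n)) := by
  rw [Finset.sum_congr rfl fun A hA =>
    (sum_admissible_sourceUnion (T := T) hS (Finset.mem_filter.1 hA).2).symm]
  rw [Finset.sum_comm' (t' := (clausesOn (Finset.univ : Finset (Fin n))).powerset.filter
      fun G => AdmissibleOn S T G Finset.univ)
    (s' := fun G => Finset.univ.filter fun A => IsSourceUnion G A)]
  swap
  · intro A G
    simp only [Finset.mem_filter, Finset.mem_univ, true_and]
    exact ⟨fun h => ⟨h.2.2.2, h.2.1, h.2.2.1⟩, fun h => ⟨h.1.1, h.2.1, h.2.2, h.1⟩⟩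
  rw [isolatedSum, Finset.inter_univ, Finset.sum_filter, Finset.sum_filter]
  refine Finset.sum_congr rfl fun G _ => ?_
  rw [← Finset.sum_mul]
  by_cases ha : AdmissibleOn S T G Finset.univ
  · rw [if_pos ha]
    by_cases hs : IsSym G
    · rw [if_pos ⟨hs, ha⟩, sum_sourceUnion_of_isSym hs]
    · rw [if_neg fun h => hs h.1, sum_sourceUnion_of_not_isSym hs, zero_mul]
  · rw [if_neg ha, if_neg fun h => ha h.2]

end

variable {k : ℕ}

/-! ### Implication digraphs as sets of clauses -/

/-- The implication digraph of a set of clauses. -/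
def toImplicationDigraph (G : Finset (Sym2 (Literal k))) : ImplicationDigraph k where
  Adj u v := u.1 ≠ v.1 ∧ Impl G u v
  adj_neg _ _ h := ⟨h.1.symm, h.2.neg⟩
  adj_var_ne _ _ h := h.1

lemma toImplicationDigraph_adj {G : Finset (Sym2 (Literal k))} (hG : G ⊆ clausesOn Finset.univ)
    {u v : Literal k} : (toImplicationDigraph G).Adj u v ↔ Impl G u v :=
  and_iff_right_of_imp fun h => (mem_clausesOn.1 (hG h)).2.2

lemma toImplicationDigraph_injOn : Set.InjOn (toImplicationDigraph (k := k))
    {G | G ⊆ clausesOn Finset.univ} := by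
  intro G hG H hH h
  ext c
  induction c with | _ u v =>
  have h1 := toImplicationDigraph_adj hG (u := u.neg) (v := v)
  have h2 := toImplicationDigraph_adj hH (u := u.neg) (v := v)
  rw [Impl, Literal.neg_neg] at h1 h2
  rw [← h1, ← h2, h]

lemma exists_toImplicationDigraph (D : ImplicationDigraph k) :
    ∃ G ⊆ clausesOn (Finset.univ : Finset (Fin k)), toImplicationDigraph G = D := by
  have key : ∀ u v, s(u.neg, v) ∈ Finset.univ.filter (fun c => ∃ u v : Literal k,
      c = s(u.neg, v) ∧ D.Adj u v) ↔ D.Adj u v := by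
    intro u v
    simp only [Finset.mem_filter, Finset.mem_univ, true_and]
    refine ⟨?_, fun h => ⟨u, v, rfl, h⟩⟩
    rintro ⟨a, b, h, hab⟩
    rcases Sym2.eq_iff.1 h with ⟨h1, rfl⟩ | ⟨h1, h2⟩
    · rwa [Literal.neg_injective h1]
    · have := D.adj_neg _ _ hab
      rwa [← h1, Literal.neg_neg, ← h2] at this
  refine ⟨Finset.univ.filter fun c => ∃ u v : Literal k, c = s(u.neg, v) ∧ D.Adj u v, ?_, ?_⟩
  · intro c hc
    obtain ⟨u, v, rfl, h⟩ := (Finset.mem_filter.1 hc).2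
    exact mem_clausesOn.2 ⟨Finset.mem_univ _, Finset.mem_univ _, fun h' => D.adj_var_ne _ _ h h'⟩
  · ext u v
    exact ⟨fun h => (key u v).1 h.2, fun h => ⟨D.adj_var_ne _ _ h, (key u v).2 h⟩⟩

lemma numArcs_toImplicationDigraph {G : Finset (Sym2 (Literal k))}
    (hG : G ⊆ clausesOn Finset.univ) :
    numArcs (toImplicationDigraph G).toDigraph = 2 * G.card := by
  have h1 : {a : Literal k × Literal k | (toImplicationDigraph G).Adj a.1 a.2} =
      ((Finset.univ.filter fun a : Literal k × Literal k => s(a.1.neg, a.2) ∈ G :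
        Finset (Literal k × Literal k)) : Set (Literal k × Literal k)) := by
    ext a
    simp only [Set.mem_ofPred_eq, Finset.coe_filter, Finset.mem_univ, true_and]
    exact toImplicationDigraph_adj hG
  have hmaps : Set.MapsTo (fun a : Literal k × Literal k => s(a.1.neg, a.2))
      ((Finset.univ.filter fun a : Literal k × Literal k => s(a.1.neg, a.2) ∈ G :
        Finset (Literal k × Literal k)) : Set (Literal k × Literal k)) (G : Set _) := fun a ha => by
    simpa using ha
  rw [numArcs, h1, Set.ncard_coe_finset, Finset.card_eq_sum_card_fiberwise hmaps,
    Finset.sum_congr rfl (g := fun _ => 2), Finset.sum_const, smul_eq_mul, mul_comm]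
  intro c
  induction c with | _ u v =>
  intro hc
  have hne : u.1 ≠ v.1 := (mem_clausesOn.1 (hG hc)).2.2
  rw [Finset.card_eq_two]
  refine ⟨(u.neg, v), (v.neg, u), fun h => hne ?_, ?_⟩
  · have := congrArg (fun p => p.2.1) h
    exact this.symm
  · ext ⟨a, b⟩
    simp only [Finset.mem_filter, Finset.mem_univ, true_and, Finset.mem_insert,
      Finset.mem_singleton, Prod.mk.injEq]
    constructor
    · rintro ⟨-, h⟩
      rcases Sym2.eq_iff.1 h with ⟨rfl, rfl⟩ | ⟨rfl, rfl⟩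
      · simp
      · simp
    · rintro (⟨rfl, rfl⟩ | ⟨rfl, rfl⟩)
      · simp [hc]
      · rw [Literal.neg_neg, Sym2.eq_swap]
        exact ⟨hc, rfl⟩

lemma coeff_sum_X_pow_card {α : Type*} (F : Finset (Finset α)) (m : ℕ) :
    coeff m (∑ G ∈ F, (X : PowerSeries ℚ) ^ G.card) =
      ((F.filter fun G => G.card = m).card : ℚ) := by
  rw [map_sum, Finset.card_filter, Nat.cast_sum]
  refine Finset.sum_congr rfl fun G _ => ?_
  rw [coeff_X_pow]
  simp [eq_comm]

/-- Sets of clauses and implication digraphs correspond bijectively, `m` clauses giving `2 * m`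
arcs. -/
lemma implicationWeight_eq_sum (B : ImplicationFamily) (k : ℕ) :
    implicationWeight B k = ∑ G ∈ (clausesOn (Finset.univ : Finset (Fin k))).powerset with
      toImplicationDigraph G ∈ B k, X ^ G.card := by
  ext m
  rw [coeff_sum_X_pow_card, implicationWeight, coeff_mk]
  congr 1
  rw [← Set.ncard_coe_finset, ← Set.InjOn.ncard_image (f := toImplicationDigraph)]
  · congr 1
    ext D
    simp only [Set.mem_ofPred_eq, Set.mem_image, Finset.mem_coe, Finset.mem_filter,
      Finset.mem_powerset]
    constructor
    · rintro ⟨hD, hm⟩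
      obtain ⟨G, hG, rfl⟩ := exists_toImplicationDigraph D
      rw [numArcs_toImplicationDigraph hG] at hm
      exact ⟨G, ⟨⟨hG, hD⟩, by omega⟩, rfl⟩
    · rintro ⟨G, ⟨⟨hG, hD⟩, hm⟩, rfl⟩
      exact ⟨hD, by rw [numArcs_toImplicationDigraph hG, hm]⟩
  · intro G hG H hH h
    simp only [Finset.mem_coe, Finset.mem_filter, Finset.mem_powerset] at hG hH
    exact toImplicationDigraph_injOn hG.1.1 hH.1.1 h

lemma isSCC_iff {V : Type*} (D : Digraph V) (C : Set V) :
    IsSCC D C ↔ ∃ u, C = {v | Reaches D u v ∧ Reaches D v u} := by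
  constructor
  · rintro ⟨⟨⟨u, hu⟩, hC⟩, hmax⟩
    refine ⟨u, Set.Subset.antisymm (fun v hv => ⟨hC u hu v hv, hC v hv u hu⟩) ?_⟩
    exact hmax ⟨⟨u, .refl, .refl⟩, fun v hv w hw => hv.2.trans hw.1⟩
      fun v hv => ⟨hC u hu v hv, hC v hv u hu⟩
  · rintro ⟨u, rfl⟩
    refine ⟨⟨⟨u, .refl, .refl⟩, fun v hv w hw => hv.2.trans hw.1⟩, ?_⟩
    rintro C ⟨_, hC⟩ hsub v hv
    have hu : u ∈ C := hsub ⟨.refl, .refl⟩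
    exact ⟨hC u hu v hv, hC v hv u hu⟩

lemma reaches_toImplicationDigraph {G : Finset (Sym2 (Literal k))}
    (hG : G ⊆ clausesOn Finset.univ) {u v : Literal k} :
    Reaches (toImplicationDigraph G).toDigraph u v ↔ Rch G u v := by
  have : (toImplicationDigraph G).Adj = Impl G := by
    ext u v
    exact toImplicationDigraph_adj hG
  rw [Reaches, this]

lemma toImplicationDigraph_mem_cnfFamily {S : DigraphFamily} {T : ImplicationFamily}
    {G : Finset (Sym2 (Literal k))} (hG : G ⊆ clausesOn Finset.univ) :
    toImplicationDigraph G ∈ cnfFamily S T k ↔ AdmissibleOn S T G Finset.univ := by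
  have hscc : ∀ C, IsSCC (toImplicationDigraph G).toDigraph C ↔ ∃ u, C = ↑(comp G u) := by
    intro C
    rw [isSCC_iff]
    refine exists_congr fun u => ?_
    simp only [reaches_toImplicationDigraph hG, comp, Finset.coe_filter, Finset.mem_univ, true_and]
  have hcon : ∀ u, IsContradictorySCC (toImplicationDigraph G) ↑(comp G u) ↔
      ¬ Consistent (comp G u) := by
    intro u
    rw [IsContradictorySCC, and_iff_right ((hscc _).2 ⟨u, rfl⟩)]
    simp only [Consistent, not_forall, not_not, exists_prop, Finset.mem_coe]
    refine exists_congr fun l => and_congr_right fun hl => ?_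
    rw [IsContradictoryVar, reaches_toImplicationDigraph hG, reaches_toImplicationDigraph hG,
      ← comp_eq_of_mem hl, mem_comp]
    rcases l with ⟨x, b⟩
    cases b
    · exact and_comm
    · exact Iff.rfl
  have hord : ∀ u, IsOrdinarySCC (toImplicationDigraph G) ↑(comp G u) ↔
      Consistent (comp G u) := by
    intro u
    rw [IsOrdinarySCC, and_iff_right ((hscc _).2 ⟨u, rfl⟩), hcon, not_not]
  have hinO : ∀ C : Finset (Literal k), InDigraphFamily (toImplicationDigraph G) C S ↔
      InOrd S G C := fun C => by
    simp only [InDigraphFamily, toImplicationDigraph_adj hG, InOrd]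
  have hinC : ∀ C : Finset (Literal k), InImplicationFamily (toImplicationDigraph G) C T ↔
      InContr T G C := fun C => by
    simp only [InImplicationFamily, toImplicationDigraph_adj hG, InContr]
  constructor
  · rintro ⟨h1, h2⟩ u -
    exact ⟨fun h => (hinO _).1 (h1 _ ((hord u).2 h)), fun h => (hinC _).1 (h2 _ ((hcon u).2 h))⟩
  · intro h
    constructor
    · intro C hC
      obtain ⟨u, rfl⟩ := (hscc C).1 hC.1
      exact (hinO _).2 ((h u (Finset.mem_univ _)).1 ((hord u).1 hC))
    · intro C hC
      obtain ⟨u, rfl⟩ := (hscc C).1 hC.1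
      exact (hinC _).2 ((h u (Finset.mem_univ _)).2 ((hcon u).1 hC))

/-! ### Relabelling -/

/-- Relabelling the variables of a literal. -/
def litMap (e : Fin k ↪o Fin n) (a : Literal k) : Literal n := (e a.1, a.2)

/-- Relabelling the variables of a set of clauses. -/
def mapClauses (e : Fin k ↪o Fin n) (G : Finset (Sym2 (Literal k))) : Finset (Sym2 (Literal n)) :=
  G.image (Sym2.map (litMap e))

section

variable (e : Fin k ↪o Fin n)

lemma litMap_injective : Function.Injective (litMap e) := by
  rintro ⟨x, b⟩ ⟨y, c⟩ h
  simp only [litMap, Prod.mk.injEq, EmbeddingLike.apply_eq_iff_eq] at h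
  exact Prod.ext h.1 h.2

lemma litMap_neg (a : Literal k) : litMap e a.neg = (litMap e a).neg := rfl

lemma impl_mapClauses {G : Finset (Sym2 (Literal k))} {a b : Literal k} :
    Impl (mapClauses e G) (litMap e a) (litMap e b) ↔ Impl G a b := by
  rw [Impl, ← litMap_neg, ← Sym2.map_mk, mapClauses,
    (Sym2.map.injective (litMap_injective e)).mem_finset_image]
  rfl

/-- Every literal in a relabelled clause is in the image of `litMap e`, so paths from the image stay
in it. -/
lemma rch_mapClauses {G : Finset (Sym2 (Literal k))} {a : Literal k} {v : Literal n} :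
    Rch (mapClauses e G) (litMap e a) v ↔ ∃ b, v = litMap e b ∧ Rch G a b := by
  constructor
  · intro h
    induction h with
    | refl => exact ⟨a, rfl, .refl⟩
    | @tail v w _ h ih =>
      obtain ⟨b, rfl, hb⟩ := ih
      obtain ⟨c, hc, hcw⟩ := Finset.mem_image.1 h
      have hw : w ∈ Sym2.map (litMap e) c := by rw [hcw]; exact Sym2.mem_mk_right _ _
      obtain ⟨d, -, rfl⟩ := Sym2.mem_map.1 hw
      exact ⟨d, rfl, hb.tail ((impl_mapClauses e).1 h)⟩
  · rintro ⟨b, rfl, h⟩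
    exact Relation.ReflTransGen.lift (litMap e) (fun _ _ h => (impl_mapClauses e).2 h) _ _ h

lemma comp_mapClauses (G : Finset (Sym2 (Literal k))) (a : Literal k) :
    comp (mapClauses e G) (litMap e a) = (comp G a).image (litMap e) := by
  ext v
  simp only [mem_comp, Finset.mem_image, rch_mapClauses]
  constructor
  · rintro ⟨⟨b, rfl, h⟩, h'⟩
    obtain ⟨c, hc, h'⟩ := (rch_mapClauses e).1 h'
    rw [← litMap_injective e hc] at h'
    exact ⟨b, ⟨h, h'⟩, rfl⟩
  · rintro ⟨b, ⟨h, h'⟩, rfl⟩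
    exact ⟨⟨b, rfl, h⟩, (rch_mapClauses e).2 ⟨a, rfl, h'⟩⟩

lemma consistent_image_litMap {C : Finset (Literal k)} :
    Consistent (C.image (litMap e)) ↔ Consistent C := by
  simp only [Consistent, Finset.forall_mem_image, ← litMap_neg,
    (litMap_injective e).mem_finset_image]

/-- An order embedding into the range of another one factors through it. -/
lemma exists_orderEmbedding_comp {j : ℕ} (f : Fin j ↪o Fin n) (h : ∀ i, ∃ x, e x = f i) :
    ∃ g : Fin j ↪o Fin k, ∀ i, e (g i) = f i := by
  choose g hg using h
  refine ⟨OrderEmbedding.ofMapLEIff g fun a b => ?_, hg⟩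
  rw [← e.le_iff_le, hg, hg, f.le_iff_le]

lemma inOrd_mapClauses {S : DigraphFamily} {G : Finset (Sym2 (Literal k))}
    {C : Finset (Literal k)} :
    InOrd S (mapClauses e G) (C.image (litMap e)) ↔ InOrd S G C := by
  constructor
  · rintro ⟨j, f, s, D, hD, hC, hadj⟩
    rw [Finset.coe_image] at hC
    have hmem : ∀ i, ∃ a ∈ C, litMap e a = (f i, s i) := fun i => by
      have : ((f i, s i) : Literal n) ∈ litMap e '' ↑C := by rw [hC]; exact ⟨i, rfl⟩
      simpa using this
    obtain ⟨g, hg⟩ := exists_orderEmbedding_comp e f fun i => by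
      obtain ⟨a, -, ha⟩ := hmem i
      exact ⟨a.1, congrArg Prod.fst ha⟩
    have hfg : ∀ i, ((f i, s i) : Literal n) = litMap e (g i, s i) := fun i => by
      rw [litMap, hg]
    refine ⟨j, g, s, D, hD, ?_, fun a b => ?_⟩
    · refine (litMap_injective e).image_injective ?_
      rw [hC, ← Set.range_comp]
      simp only [hfg]
      rfl
    · rw [hadj, hfg, hfg, impl_mapClauses]
  · rintro ⟨j, f, s, D, hD, hC, hadj⟩
    refine ⟨j, f.trans e, s, D, hD, ?_, fun a b => ?_⟩
    · rw [Finset.coe_image, hC, ← Set.range_comp]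
      rfl
    · rw [hadj, ← impl_mapClauses e]
      rfl

lemma inContr_mapClauses {T : ImplicationFamily} {G : Finset (Sym2 (Literal k))}
    {C : Finset (Literal k)} :
    InContr T (mapClauses e G) (C.image (litMap e)) ↔ InContr T G C := by
  constructor
  · rintro ⟨j, f, D, hD, hC, hadj⟩
    rw [Finset.coe_image] at hC
    have hmem : ∀ b : Literal j, ∃ a ∈ C, litMap e a = (f b.1, b.2) := fun i => by
      have : ((f i.1, i.2) : Literal n) ∈ litMap e '' ↑C := by rw [hC]; exact ⟨i, rfl⟩
      simpa using this
    obtain ⟨g, hg⟩ := exists_orderEmbedding_comp e f fun i => by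
      obtain ⟨a, -, ha⟩ := hmem (i, true)
      exact ⟨a.1, congrArg Prod.fst ha⟩
    have hfg : ∀ i : Literal j, ((f i.1, i.2) : Literal n) = litMap e (g i.1, i.2) := fun i => by
      rw [litMap, hg]
    refine ⟨j, g, D, hD, ?_, fun a b => ?_⟩
    · refine (litMap_injective e).image_injective ?_
      rw [hC, ← Set.range_comp]
      simp only [hfg]
      rfl
    · rw [hadj, hfg, hfg, impl_mapClauses]
  · rintro ⟨j, f, D, hD, hC, hadj⟩
    refine ⟨j, f.trans e, D, hD, ?_, fun a b => ?_⟩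
    · rw [Finset.coe_image, hC, ← Set.range_comp]
      rfl
    · rw [hadj, ← impl_mapClauses e]
      rfl

lemma clausesOn_eq_mapClauses {W : Finset (Fin n)} (hW : (W : Set (Fin n)) = Set.range e) :
    clausesOn W = mapClauses e (clausesOn Finset.univ) := by
  have hm : ∀ x, x ∈ W ↔ ∃ i, e i = x := fun x => by rw [← Finset.mem_coe, hW]; rfl
  ext c
  simp only [mapClauses, Finset.mem_image]
  constructor
  · induction c with | _ u v =>
    rw [mem_clausesOn, hm, hm]
    rintro ⟨⟨i, hi⟩, ⟨j, hj⟩, huv⟩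
    refine ⟨s((i, u.2), (j, v.2)), mem_clausesOn.2 ⟨Finset.mem_univ _, Finset.mem_univ _,
      fun h => huv ?_⟩, ?_⟩
    · rw [← hi, ← hj]
      exact congrArg e h
    · rw [Sym2.map_mk, litMap, litMap, hi, hj]
  · rintro ⟨d, hd, rfl⟩
    induction d with | _ u v =>
    rw [Sym2.map_mk, mem_clausesOn, hm, hm]
    refine ⟨⟨u.1, rfl⟩, ⟨v.1, rfl⟩, fun h => (mem_clausesOn.1 hd).2.2 (e.injective h)⟩

/-- The sum over the sets of clauses on `W`, after relabelling. -/
lemma sum_powerset_clausesOn {W : Finset (Fin n)} (hW : (W : Set (Fin n)) = Set.range e)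
    (P : Finset (Sym2 (Literal n)) → Prop) (B : ImplicationFamily)
    (h : ∀ G ⊆ clausesOn (Finset.univ : Finset (Fin k)),
      (P (mapClauses e G) ↔ toImplicationDigraph G ∈ B k)) :
    ∑ G ∈ (clausesOn W).powerset with P G, (X : PowerSeries ℚ) ^ G.card =
      implicationWeight B k := by
  have hinj := Sym2.map.injective (litMap_injective e)
  rw [implicationWeight_eq_sum, Finset.sum_filter, Finset.sum_filter,
    clausesOn_eq_mapClauses e hW, mapClauses, Finset.powerset_image, Finset.sum_image]
  · refine Finset.sum_congr rfl fun G hG => ?_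
    have := h G (Finset.mem_powerset.1 hG)
    rw [mapClauses] at this
    rw [Finset.card_image_of_injective _ hinj]
    simp only [this]
  · exact fun G _ H _ h => Finset.image_injective hinj h

end

/-- The weight of the admissible implication digraphs depends only on the number of variables. -/
lemma cnfSum_eq (S : DigraphFamily) (T : ImplicationFamily) (W : Finset (Fin n)) :
    cnfSum S T W = implicationWeight (cnfFamily S T) W.card := by
  have hW : (W : Set (Fin n)) = Set.range (W.orderEmbOfFin rfl) := by
    rw [Finset.range_orderEmbOfFin]
  generalize W.orderEmbOfFin rfl = e at hW
  have hm : ∀ x, x ∈ W ↔ ∃ i, e i = x := fun x => by rw [← Finset.mem_coe, hW]; rfl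
  refine sum_powerset_clausesOn e hW _ _ fun G hG => ?_
  rw [toImplicationDigraph_mem_cnfFamily hG]
  have key : ∀ a, Admissible S T (mapClauses e G) (comp (mapClauses e G) (litMap e a)) ↔
      Admissible S T G (comp G a) := fun a => by
    rw [Admissible, comp_mapClauses, consistent_image_litMap, inOrd_mapClauses,
      inContr_mapClauses, Admissible]
  constructor
  · exact fun h a _ => (key a).1 (h _ ((hm _).2 ⟨a.1, rfl⟩))
  · rintro h u hu
    obtain ⟨i, hi⟩ := (hm _).1 hu
    have : u = litMap e (i, u.2) := by rw [litMap, hi]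
    rw [this]
    exact (key _).2 (h _ (Finset.mem_univ _))

/-- The weight of the contradictory components with a given set of variables. -/
lemma sum_inContr (T : ImplicationFamily) (U : Finset (Fin n)) :
    ∑ G ∈ (clausesOn U).powerset with
        InContr T G (Finset.univ.filter fun l : Literal n => l.1 ∈ U),
      (X : PowerSeries ℚ) ^ G.card = implicationWeight T U.card := by
  have hU : (U : Set (Fin n)) = Set.range (U.orderEmbOfFin rfl) := by
    rw [Finset.range_orderEmbOfFin]
  generalize U.orderEmbOfFin rfl = e at hU
  have hm : ∀ x, x ∈ U ↔ ∃ i, e i = x := fun x => by rw [← Finset.mem_coe, hU]; rfl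
  have hlits : (Finset.univ.filter fun l : Literal n => l.1 ∈ U) =
      Finset.univ.image (litMap e) := by
    ext l
    simp only [Finset.mem_filter, Finset.mem_univ, true_and, Finset.mem_image, hm]
    constructor
    · rintro ⟨i, hi⟩
      exact ⟨(i, l.2), by rw [litMap, hi]⟩
    · rintro ⟨a, rfl⟩
      exact ⟨a.1, rfl⟩
  refine sum_powerset_clausesOn e hU _ _ fun G hG => ?_
  rw [hlits, inContr_mapClauses]
  constructor
  · rintro ⟨j, f, D, hD, hC, hadj⟩
    have hsurj : Function.Surjective f := fun x => by
      have : ((x, true) : Literal _) ∈ ((Finset.univ : Finset (Literal U.card)) : Set _) := by simp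
      rw [hC] at this
      obtain ⟨a, ha⟩ := this
      exact ⟨a.1, congrArg Prod.fst ha⟩
    obtain rfl : j = U.card := by
      simpa using Fintype.card_of_bijective ⟨f.injective, hsurj⟩
    -- An increasing bijection of `Fin U.card` is the identity, so the relabelling is unique and the
    -- family need not be closed under isomorphism.
    have hf : (f : Fin U.card → Fin U.card) = id :=
      (StrictMono.range_inj f.strictMono strictMono_id).1 (by rw [hsurj.range_eq, Set.range_id])
    have : toImplicationDigraph G = D := by
      ext u v
      rw [toImplicationDigraph_adj hG, hadj, hf]
      rfl
    rwa [this]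
  · intro h
    refine ⟨_, RelEmbedding.refl _, _, h, ?_, fun a b => ?_⟩
    · simp
    · exact toImplicationDigraph_adj hG

/-! ### Weights of the components -/

section

variable {S : DigraphFamily} {T : ImplicationFamily} {H : Finset (Sym2 (Literal n))}
  {A : Finset (Literal n)}

lemma impl_mem_clausesIn (hA : Consistent A) {u v : Literal n} (hu : u ∈ A) :
    Impl (clausesIn A) u v ↔ u.1 ≠ v.1 ∧ v ∈ A := by
  rw [Impl, mem_clausesIn, Literal.neg_neg, Literal.neg_fst]
  have := hA u hu
  tauto

lemma mem_of_rch_clausesIn (hA : Consistent A) (hH : H ⊆ clausesIn A) {u v : Literal n}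
    (hu : u ∈ A) (h : Rch H u v) : v ∈ A := by
  induction h with
  | refl => exact hu
  | tail _ h ih => exact ((impl_mem_clausesIn hA ih).1 (hH h)).2

lemma card_vars (hA : Consistent A) : (vars A).card = A.card := by
  refine Finset.card_image_of_injOn fun k hk l hl h => ?_
  rcases Literal.eq_or_eq_neg h with h | rfl
  · exact h
  · exact absurd hk (hA l hl)

/-- The digraphs on a consistent set that form one pair of ordinary components. -/
lemma atom_iff_inOrd (hS : IsOrdinarySCCFamily S) (hA : Consistent A) (hne : A.Nonempty)
    (hH : H ⊆ clausesIn A) :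
    (IsSym H ∧ AdmissibleOn S T H (vars A) ∧ ∀ x ∈ vars A, vcomp H x = vars A) ↔
      InOrd S H A := by
  constructor
  · rintro ⟨-, hadm, hv⟩
    obtain ⟨u, hu⟩ := hne
    have hsub : comp H u ⊆ A := fun v hv => mem_of_rch_clausesIn hA hH hu (mem_comp.1 hv).1
    have heq : comp H u = A := by
      refine Finset.Subset.antisymm hsub fun v hvA => ?_
      have h1 : v.1 ∈ vcomp H u.1 := by
        rw [hv _ (mem_vars.2 (.inl hu))]; exact mem_vars.2 (.inl hvA)
      rcases mem_comp_or_of_mem_vcomp h1 with h | h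
      · exact h
      · exact absurd (hsub h) (hA v hvA)
    rw [← heq]
    refine (hadm u (mem_vars.2 (.inl hu))).1 ?_
    rwa [heq]
  · intro h
    have hcomp : ∀ u ∈ A, comp H u = A := fun u hu => by
      refine Finset.Subset.antisymm
        (fun v hv => mem_of_rch_clausesIn hA hH hu (mem_comp.1 hv).1) fun v hv => ?_
      exact mem_comp.2 ⟨h.rch hS hu hv, h.rch hS hv hu⟩
    refine ⟨?_, fun u hu => ?_, fun x hx => ?_⟩
    · rw [isSym_iff]
      intro u v huv
      rcases (mem_clausesIn.1 (hH huv)).2 with h1 | h1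
      · rw [Literal.neg_neg] at h1
        exact h.rch hS h1.2 h1.1
      · have h3 := rch_neg (h.rch hS h1.2 h1.1)
        rwa [Literal.neg_neg, Literal.neg_neg] at h3
    · have key : ∀ u ∈ A, Admissible S T H (comp H u) := fun u hu => by
        rw [hcomp u hu]
        exact ⟨fun _ => h, fun h' => absurd hA h'⟩
      rcases mem_vars.1 hu with h' | h'
      · exact key u h'
      · have := admissible_comp_neg hS (key _ h')
        rwa [Literal.neg_neg] at this
    · obtain ⟨u, hu, rfl⟩ := Finset.mem_image.1 hx
      rw [← image_fst_comp, hcomp u hu]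

lemma compSign_vars (hA : Consistent A) (hH : H ⊆ clausesIn A) : compSign H (vars A) = -1 := by
  unfold compSign
  rw [if_pos]
  intro x hx
  obtain ⟨u, hu, rfl⟩ := Finset.mem_image.1 hx
  refine (consistent_comp_congr (u := u) (v := (u.1, true)) (self_mem_vcomp _ _)).2 ?_
  exact fun k hk hk' => hA k (mem_of_rch_clausesIn hA hH hu (mem_comp.1 hk).1)
    (mem_of_rch_clausesIn hA hH hu (mem_comp.1 hk').1)

/-- The weight of the ordinary components on a given consistent set of literals. -/
lemma sum_inOrd (hS : IsOrdinarySCCFamily S) (hA : Consistent A) :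
    ∑ H ∈ (clausesIn A).powerset with InOrd S H A, (X : PowerSeries ℚ) ^ H.card =
      digraphWeight S A.card := by
  rw [← card_vars hA]
  have hU : (vars A : Set (Fin n)) = Set.range ((vars A).orderEmbOfFin rfl) := by
    rw [Finset.range_orderEmbOfFin]
  generalize (vars A).orderEmbOfFin rfl = e at hU
  have hm : ∀ x, x ∈ vars A ↔ ∃ i, e i = x := fun x => by rw [← Finset.mem_coe, hU]; rfl
  have hex : ∀ i, ∃ b, (e i, b) ∈ A := fun i => by
    obtain ⟨l, hl, hli⟩ := Finset.mem_image.1 ((hm (e i)).2 ⟨i, rfl⟩)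
    exact ⟨l.2, by rw [← hli]; exact hl⟩
  choose s hs using hex
  -- By consistency, `A` prescribes one sign for each of its variables.
  have huniq : ∀ i b, (e i, b) ∈ A → b = s i := by
    intro i b hb
    by_contra hne
    have h1 := hA _ (hs i)
    have h2 : b = !s i := by
      revert hne; cases b <;> cases s i <;> simp
    rw [h2] at hb
    exact h1 hb
  have hmem : ∀ l, l ∈ A ↔ ∃ i, l = (e i, s i) := by
    intro l
    constructor
    · intro hl
      obtain ⟨i, hi⟩ := (hm l.1).1 (mem_vars.2 (.inl hl))
      have : l = (e i, l.2) := by rw [hi]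
      refine ⟨i, ?_⟩
      rw [this] at hl
      rw [this, ← huniq i _ hl]
    · rintro ⟨i, rfl⟩
      exact hs i
  have hAr : (A : Set (Literal n)) = Set.range fun i => ((e i, s i) : Literal n) := by
    ext l
    rw [Finset.mem_coe, hmem]
    exact exists_congr fun i => eq_comm
  let D : Finset (Sym2 (Literal n)) → Digraph (Fin (vars A).card) := fun H =>
    ⟨fun i j => Impl H (e i, s i) (e j, s j)⟩
  have hInOrd : ∀ H, InOrd S H A ↔ D H ∈ S (vars A).card := by
    intro H
    constructor
    · rintro ⟨j, f, t, E, hE, hC, hadj⟩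
      have hfr : Set.range f = Set.range e := by
        rw [← hU]
        ext x
        rw [Finset.mem_coe, Finset.mem_image]
        constructor
        · rintro ⟨i, rfl⟩
          refine ⟨(f i, t i), ?_, rfl⟩
          rw [← Finset.mem_coe, hC]
          exact ⟨i, rfl⟩
        · rintro ⟨l, hl, rfl⟩
          rw [← Finset.mem_coe, hC] at hl
          obtain ⟨i, rfl⟩ := hl
          exact ⟨i, rfl⟩
      obtain rfl : j = (vars A).card := by
        have h1 := Set.ncard_range_of_injective f.injective
        rw [hfr, Set.ncard_range_of_injective e.injective] at h1
        simpa using h1.symm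
      -- An increasing enumeration is determined by its range, so the witnesses of `InOrd` are
      -- forced.
      obtain rfl : f = e :=
        DFunLike.coe_injective ((StrictMono.range_inj f.strictMono e.strictMono).1 hfr)
      obtain rfl : t = s := by
        funext i
        refine huniq i _ ?_
        rw [← Finset.mem_coe, hC]
        exact ⟨i, rfl⟩
      have : D H = E := by
        ext i j
        exact (hadj i j).symm
      rwa [this]
    · intro h
      exact ⟨_, e, s, D H, h, hAr, fun _ _ => Iff.rfl⟩
  have hclause : ∀ c, c ∈ clausesIn A ↔ ∃ i j, i ≠ j ∧
      c = s(Literal.neg (e i, s i), (e j, s j)) := by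
    intro c
    constructor
    · intro hc
      obtain ⟨k, l, rfl, hk, hl⟩ := (Finset.mem_filter.1 hc).2
      obtain ⟨i, hi⟩ := (hmem _).1 hk
      obtain ⟨j, rfl⟩ := (hmem _).1 hl
      have hk' : k = Literal.neg (e i, s i) := by rw [← hi, Literal.neg_neg]
      refine ⟨i, j, ?_, by rw [hk']⟩
      rintro rfl
      exact (mem_clausesIn.1 hc).1 (by rw [hk', Literal.neg_fst])
    · rintro ⟨i, j, hij, rfl⟩
      rw [mem_clausesIn, Literal.neg_neg]
      exact ⟨fun h => hij (e.injective h), .inl ⟨hs i, hs j⟩⟩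
  -- A clause inside `A` encodes only one arc within `A`: matching the two literals the other way
  -- round would put a literal and its negation in `A`.
  have hpair : ∀ i j i' j', s(Literal.neg (e i, s i), ((e j, s j) : Literal n)) =
      s(Literal.neg (e i', s i'), (e j', s j')) → i = i' ∧ j = j' := by
    intro i j i' j' h
    rcases Sym2.eq_iff.1 h with ⟨h1, h2⟩ | ⟨h1, h2⟩
    · exact ⟨e.injective (congrArg Prod.fst h1), e.injective (congrArg Prod.fst h2)⟩
    · exact absurd (h1 ▸ hs j' : Literal.neg (e i, s i) ∈ A) (hA _ (hs i))
  have harcs : ∀ H ⊆ clausesIn A, numArcs (D H) = H.card := by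
    intro H hH
    refine Eq.trans ?_ (Set.ncard_coe_finset H)
    refine Set.ncard_congr (fun p _ => s(Literal.neg (e p.1, s p.1), (e p.2, s p.2)))
      (fun p hp => hp) (fun p q _ _ h => ?_) fun c hc => ?_
    · have := hpair _ _ _ _ h
      exact Prod.ext this.1 this.2
    · obtain ⟨i, j, -, rfl⟩ := (hclause c).1 (hH hc)
      exact ⟨(i, j), hc, rfl⟩
  ext m
  rw [coeff_sum_X_pow_card, digraphWeight, coeff_mk]
  congr 1
  rw [← Set.ncard_coe_finset, ← Set.InjOn.ncard_image (f := D)]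
  · congr 1
    ext E
    simp only [Set.mem_ofPred_eq, Set.mem_image, Finset.mem_coe, Finset.mem_filter,
      Finset.mem_powerset]
    constructor
    · rintro ⟨H, ⟨⟨hH, hD⟩, hm⟩, rfl⟩
      exact ⟨(hInOrd H).1 hD, by rw [harcs H hH, hm]⟩
    · rintro ⟨hE, hm⟩
      let H := (clausesIn A).filter fun c => ∃ i j, E.Adj i j ∧
        c = s(Literal.neg (e i, s i), (e j, s j))
      have hH : H ⊆ clausesIn A := Finset.filter_subset _ _
      have hDH : D H = E := by
        ext i j
        constructor
        · intro h
          obtain ⟨i', j', h1, h2⟩ := (Finset.mem_filter.1 h).2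
          obtain ⟨rfl, rfl⟩ := hpair _ _ _ _ h2
          exact h1
        · intro h
          refine Finset.mem_filter.2 ⟨(hclause _).2 ⟨i, j, ?_, rfl⟩, i, j, h, rfl⟩
          -- Loops cannot be encoded, as a clause has two distinct variables; looplessness of the
          -- family excludes them.
          rintro rfl
          exact hS.loopless _ _ hE _ h
      exact ⟨H, ⟨⟨hH, (hInOrd H).2 (hDH ▸ hE)⟩, by rw [← harcs H hH, hDH, hm]⟩, hDH⟩
  · intro H hH H' hH' h
    simp only [Finset.mem_coe, Finset.mem_filter, Finset.mem_powerset] at hH hH'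
    have hadj : ∀ i j, s(Literal.neg (e i, s i), ((e j, s j) : Literal n)) ∈ H ↔
        s(Literal.neg (e i, s i), ((e j, s j) : Literal n)) ∈ H' := fun i j => by
      have := congrArg (fun E : Digraph (Fin (vars A).card) => E.Adj i j) h
      exact iff_of_eq this
    ext c
    constructor
    · intro hc
      obtain ⟨i, j, -, rfl⟩ := (hclause c).1 (hH.1.1 hc)
      exact (hadj i j).1 hc
    · intro hc
      obtain ⟨i, j, -, rfl⟩ := (hclause c).1 (hH'.1.1 hc)
      exact (hadj i j).2 hc

lemma Consistent.mono (hA : Consistent A) {B : Finset (Literal n)} (h : B ⊆ A) : Consistent B :=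
  fun l hl hl' => hA l (h hl) (h hl')

/-- Clauses in `A` can only form the pair consisting of the restriction `B` of `A` to `U` and the
negation of `B`, so no choice of signs is left and the weight is that of one digraph of the family.
-/
lemma atomSum_clausesIn (hS : IsOrdinarySCCFamily S) (hA : Consistent A) {U : Finset (Fin n)}
    (hU : U ⊆ vars A) (hne : U.Nonempty) :
    atomSum S T (clausesIn A) U = -digraphWeight S U.card := by
  obtain ⟨B, hB⟩ : ∃ B, B = A.filter fun l => l.1 ∈ U := ⟨_, rfl⟩
  have hBA : B ⊆ A := hB ▸ Finset.filter_subset _ _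
  have hBc := hA.mono hBA
  have hBv : vars B = U := by
    ext x
    rw [hB, Finset.mem_image]
    constructor
    · rintro ⟨l, hl, rfl⟩
      exact (Finset.mem_filter.1 hl).2
    · intro hx
      obtain ⟨l, hl, rfl⟩ := Finset.mem_image.1 (hU hx)
      exact ⟨l, Finset.mem_filter.2 ⟨hl, hx⟩, rfl⟩
  have hBne : B.Nonempty := by
    rw [← hBv] at hne
    exact Finset.image_nonempty.1 hne
  have hcl : clausesOn U ∩ clausesIn A = clausesIn B := by
    ext c
    induction c with | _ k l =>
    rw [Finset.mem_inter, mem_clausesOn, mem_clausesIn, mem_clausesIn, hB]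
    simp only [Finset.mem_filter, Literal.neg_fst]
    tauto
  rw [atomSum, hcl, ← hBv, card_vars hBc, ← sum_inOrd hS hBc, ← Finset.sum_neg_distrib]
  refine Finset.sum_congr (Finset.filter_congr fun H hH =>
    atom_iff_inOrd hS hBc hBne (Finset.mem_powerset.1 hH)) fun H hH => ?_
  rw [compSign_vars hBc (Finset.mem_powerset.1 (Finset.mem_filter.1 hH).1), neg_one_mul]

/-- Strong connectivity excludes the empty digraph, so the series has no constant term and may be
substituted into the exponential. -/
lemma digraphWeight_zero (hS : IsOrdinarySCCFamily S) : digraphWeight S 0 = 0 := by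
  ext m
  rw [digraphWeight, coeff_mk]
  have : {D ∈ S 0 | numArcs D = m} = ∅ := by
    ext D
    simp only [Set.mem_ofPred_eq, Set.mem_empty_iff_false, iff_false]
    rintro ⟨hD, -⟩
    exact (hS.stronglyConnected _ _ hD).1.elim fun x => x.elim0
  rw [this]
  simp

lemma implicationWeight_zero (hT : IsContradictorySCCFamily T) : implicationWeight T 0 = 0 := by
  ext m
  rw [implicationWeight, coeff_mk]
  have : {D ∈ T 0 | numArcs D.toDigraph = 2 * m} = ∅ := by
    ext D
    simp only [Set.mem_ofPred_eq, Set.mem_empty_iff_false, iff_false]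
    rintro ⟨hD, -⟩
    exact (hT _ _ hD).1.elim fun x => x.1.elim0
  rw [this]
  simp

/-- The number of choices of signs for a set of variables. -/
lemma card_consistent_vars (U : Finset (Fin n)) :
    (Finset.univ.filter fun A : Finset (Literal n) => Consistent A ∧ vars A = U).card =
      2 ^ U.card := by
  rw [← Finset.card_powerset]
  refine Finset.card_bij' (fun A _ => U.filter fun x => (x, true) ∈ A)
    (fun P _ => U.image fun x => (x, decide (x ∈ P))) ?_ ?_ ?_ ?_
  · intro A _
    simp
  · intro P _
    simp only [Finset.mem_filter, Finset.mem_univ, true_and]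
    constructor
    · intro l hl hl'
      obtain ⟨x, -, rfl⟩ := Finset.mem_image.1 hl
      obtain ⟨y, -, h⟩ := Finset.mem_image.1 hl'
      have h1 : y = x := congrArg Prod.fst h
      have h2 : decide (y ∈ P) = !decide (x ∈ P) := congrArg Prod.snd h
      rw [h1] at h2
      simp at h2
    · rw [vars, Finset.image_image]
      exact Finset.image_id
  · intro A hA
    simp only [Finset.mem_filter, Finset.mem_univ, true_and] at hA
    obtain ⟨hA, rfl⟩ := hA
    ext ⟨x, b⟩
    simp only [Finset.mem_image, Finset.mem_filter, Prod.mk.injEq]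
    constructor
    · rintro ⟨y, ⟨l, hl, rfl⟩, rfl, rfl⟩
      rcases l with ⟨y, c⟩
      have h1 := hA _ hl
      cases c
      · have : (y, true) ∉ A := h1
        simpa [this] using hl
      · have : ∃ x ∈ A, x.1 = y := ⟨_, hl, rfl⟩
        simp [hl]
    · intro h
      refine ⟨x, ⟨_, h, rfl⟩, rfl, ?_⟩
      have h1 := hA _ h
      cases b
      · have : (x, true) ∉ A := h1
        simp [this]
      · simp only [h, and_true, decide_eq_true_eq]
        exact ⟨_, h, rfl⟩
  · intro P hP
    simp only [Finset.mem_powerset] at hP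
    ext x
    simp only [Finset.mem_filter, Finset.mem_image, Prod.mk.injEq, decide_eq_true_eq]
    constructor
    · rintro ⟨-, y, -, rfl, h⟩
      exact h
    · intro h
      exact ⟨hP h, x, hP h, rfl, h⟩

lemma consistent_image_neg : Consistent (A.image Literal.neg) ↔ Consistent A := by
  simp only [Consistent, Finset.forall_mem_image, Literal.neg_injective.mem_finset_image]

lemma two_mul_card_consistent_vars_mem {U : Finset (Fin n)} {x : Fin n} (hx : x ∈ U) :
    2 * (Finset.univ.filter fun A : Finset (Literal n) =>
      (Consistent A ∧ vars A = U) ∧ (x, true) ∈ A).card = 2 ^ U.card := by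
  rw [← card_consistent_vars, ← Finset.card_filter_add_card_filter_not
    (s := Finset.univ.filter fun A : Finset (Literal n) => Consistent A ∧ vars A = U)
    (p := fun A => ((x, true) : Literal n) ∈ A), Finset.filter_filter, Finset.filter_filter,
    two_mul, Nat.add_left_cancel_iff]
  have hinv : ∀ A : Finset (Literal n), (A.image Literal.neg).image Literal.neg = A := fun A => by
    have h : Literal.neg ∘ Literal.neg = (id : Literal n → Literal n) := funext Literal.neg_neg
    rw [Finset.image_image, h, Finset.image_id]
  have hvars : ∀ A : Finset (Literal n), vars (A.image Literal.neg) = vars A := fun A => by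
    rw [vars, Finset.image_image]
    rfl
  -- Negation exchanges the sign choices that contain `(x, true)` with those that do not.
  refine Finset.card_bij' (fun A _ => A.image Literal.neg) (fun A _ => A.image Literal.neg)
    ?_ ?_ (fun A _ => hinv A) fun A _ => hinv A
  · intro A hA
    simp only [Finset.mem_filter, Finset.mem_univ, true_and] at hA ⊢
    refine ⟨⟨consistent_image_neg.2 hA.1.1, (hvars A).trans hA.1.2⟩, fun h => ?_⟩
    obtain ⟨k, hk, hkx⟩ := Finset.mem_image.1 h
    have := hA.1.1 _ hk
    rw [hkx] at this
    exact this hA.2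
  · intro A hA
    simp only [Finset.mem_filter, Finset.mem_univ, true_and] at hA ⊢
    refine ⟨⟨consistent_image_neg.2 hA.1.1, (hvars A).trans hA.1.2⟩, ?_⟩
    have h1 : ((x, true) : Literal n).1 ∈ vars A := by rw [hA.1.2]; exact hx
    exact Finset.mem_image.2 ⟨Literal.neg (x, true), (mem_vars.1 h1).resolve_left hA.2,
      Literal.neg_neg _⟩

/-- The sets of clauses that form one contradictory component. -/
lemma atom_iff_inContr (hT : IsContradictorySCCFamily T) {U : Finset (Fin n)} {x : Fin n}
    (hx : x ∈ U) (hH : H ⊆ clausesOn U) :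
    ((IsSym H ∧ AdmissibleOn S T H U ∧ ∀ x ∈ U, vcomp H x = U) ∧
        ¬ Consistent (comp H (x, true))) ↔
      InContr T H (Finset.univ.filter fun l : Literal n => l.1 ∈ U) := by
  have hm : ∀ l : Literal n, l ∈ (Finset.univ.filter fun l : Literal n => l.1 ∈ U) ↔ l.1 ∈ U :=
    fun l => by simp
  generalize (Finset.univ.filter fun l : Literal n => l.1 ∈ U) = C at hm
  constructor
  · rintro ⟨⟨-, hadm, hv⟩, hc⟩
    -- The component meets every variable of `U` and, being contradictory, is closed under negation,
    -- so it contains all literals on `U`.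
    have : comp H (x, true) = C := by
      ext l
      rw [hm]
      constructor
      · exact fun h => fst_mem_of_rch hH (mem_comp.1 h).1 hx
      · intro hl
        have h1 : l.1 ∈ vcomp H x := by rw [hv x hx]; exact hl
        rcases mem_comp_or_of_mem_vcomp (u := (x, true)) h1 with h | h
        · exact h
        · rwa [← mem_comp_neg, comp_neg_eq_of_not_consistent hc] at h
    rw [← this]
    exact (hadm (x, true) hx).2 hc
  · intro h
    have hcomp : ∀ u : Literal n, u.1 ∈ U → comp H u = C := by
      intro u hu
      ext l
      rw [hm]
      refine ⟨fun h => fst_mem_of_rch hH (mem_comp.1 h).1 hu, fun hl => ?_⟩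
      rw [← hm] at hl hu
      exact mem_comp.2 ⟨h.rch hT hu hl, h.rch hT hl hu⟩
    have hcons : ¬ Consistent C := fun h' => h' (x, true) ((hm _).2 hx) ((hm _).2 hx)
    refine ⟨⟨?_, fun u hu => ?_, fun y hy => ?_⟩, by rwa [hcomp _ hx]⟩
    · rw [isSym_iff]
      intro u v huv
      have := mem_clausesOn.1 (hH huv)
      exact h.rch hT ((hm _).2 this.2.1) ((hm _).2 this.1)
    · rw [hcomp u hu]
      exact ⟨fun h' => absurd h' hcons, fun _ => h⟩
    · rw [vcomp, hcomp _ hy]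
      ext z
      rw [Finset.mem_image]
      constructor
      · rintro ⟨l, hl, rfl⟩
        exact (hm l).1 hl
      · exact fun hz => ⟨(z, true), (hm _).2 hz, rfl⟩

/-- The sets of clauses that form one pair of ordinary components, one of them being `A`. -/
lemma atom_comp_eq_iff (hS : IsOrdinarySCCFamily S) {x : Fin n} (hA : Consistent A)
    (hx : (x, true) ∈ A) :
    (H ⊆ clausesOn (vars A) ∧
      (IsSym H ∧ AdmissibleOn S T H (vars A) ∧ ∀ x ∈ vars A, vcomp H x = vars A) ∧
      comp H (x, true) = A) ↔ H ⊆ clausesIn A ∧ InOrd S H A := by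
  constructor
  · rintro ⟨hH, h, hc⟩
    have hsub : H ⊆ clausesIn A := by
      intro c
      induction c with | _ k l =>
      intro hkl
      have h3 := mem_clausesOn.1 (hH hkl)
      have hstep : ∀ u v, Rch H u v → u ∈ A → v ∈ A := fun u v huv hu => by
        rw [← hc] at hu ⊢
        rw [← comp_eq_of_mem hu]
        exact h.1.mem_comp.2 huv
      rw [mem_clausesIn]
      refine ⟨h3.2.2, ?_⟩
      have hi : Impl H k.neg l := by rwa [Impl, Literal.neg_neg]
      rcases mem_vars.1 h3.1 with hk | hk
      · refine .inr ⟨hstep k l.neg ?_ hk, hk⟩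
        have := hi.neg
        rw [Literal.neg_neg] at this
        exact h.1 _ _ (.single this)
      · exact .inl ⟨hk, hstep _ _ (.single hi) hk⟩
    exact ⟨hsub, (atom_iff_inOrd hS hA ⟨_, hx⟩ hsub).1 h⟩
  · rintro ⟨hH, h⟩
    refine ⟨hH.trans clausesIn_subset, (atom_iff_inOrd hS hA ⟨_, hx⟩ hH).2 h, ?_⟩
    refine Finset.Subset.antisymm
      (fun v hv => mem_of_rch_clausesIn hA hH hx (mem_comp.1 hv).1) fun v hv => ?_
    exact mem_comp.2 ⟨h.rch hS hx hv, h.rch hS hv hx⟩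

/-- The component of `(x, true)` is either contradictory, on all literals of `U`, or ordinary. In
the second case it singles out one member of the pair, which leaves half of the `2 ^ U.card` sign
choices, each with weight `-digraphWeight S U.card`. -/
lemma atomSum_univ (hS : IsOrdinarySCCFamily S) (hT : IsContradictorySCCFamily T)
    {U : Finset (Fin n)} (hne : U.Nonempty) :
    atomSum S T Finset.univ U =
      implicationWeight T U.card - (2 ^ U.card / 2 : ℚ) • digraphWeight S U.card := by
  obtain ⟨x, hx⟩ := hne
  rw [atomSum, Finset.inter_univ,
    ← Finset.sum_filter_not_add_sum_filter _ fun H => Consistent (comp H (x, true)),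
    sub_eq_add_neg]
  congr 1
  · rw [← sum_inContr, Finset.filter_filter]
    refine Finset.sum_congr (Finset.filter_congr fun H hH =>
      atom_iff_inContr hT hx (Finset.mem_powerset.1 hH)) fun H hH => ?_
    obtain ⟨hH, h⟩ := Finset.mem_filter.1 hH
    have h := (atom_iff_inContr (S := S) hT hx (Finset.mem_powerset.1 hH)).2 h
    unfold compSign
    rw [if_neg fun h' => h.2 (h' x hx), one_mul]
  · rw [Finset.filter_filter, ← Finset.sum_fiberwise_of_maps_to (g := fun H => comp H (x, true))
      (t := Finset.univ.filter fun A : Finset (Literal n) =>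
        (Consistent A ∧ vars A = U) ∧ (x, true) ∈ A)]
    · have hterm : ∀ A ∈ Finset.univ.filter (fun A : Finset (Literal n) =>
          (Consistent A ∧ vars A = U) ∧ (x, true) ∈ A),
          (∑ H ∈ ((clausesOn U).powerset.filter fun H =>
              (IsSym H ∧ AdmissibleOn S T H U ∧ ∀ x ∈ U, vcomp H x = U) ∧
                Consistent (comp H (x, true))).filter fun H => comp H (x, true) = A,
            compSign H U * X ^ H.card) = -digraphWeight S U.card := by
        intro A hA
        simp only [Finset.mem_filter, Finset.mem_univ, true_and] at hA
        obtain ⟨⟨hA, rfl⟩, hxA⟩ := hA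
        rw [card_vars hA, ← sum_inOrd hS hA, ← Finset.sum_neg_distrib]
        refine Finset.sum_congr ?_ fun H hH => ?_
        · ext H
          have := atom_comp_eq_iff (T := T) (H := H) hS hA hxA
          simp only [Finset.mem_filter, Finset.mem_powerset]
          rw [← this]
          constructor
          · exact fun h => ⟨h.1.1, h.1.2.1, h.2⟩
          · exact fun h => ⟨⟨h.1, h.2.1, by rwa [h.2.2]⟩, h.2.2⟩
        · rw [compSign_vars hA (Finset.mem_powerset.1 (Finset.mem_filter.1 hH).1), neg_one_mul]
      rw [Finset.sum_congr rfl hterm, Finset.sum_const, ← Nat.cast_smul_eq_nsmul ℚ, smul_neg]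
      congr 2
      rw [eq_div_iff two_ne_zero, mul_comm]
      exact_mod_cast two_mul_card_consistent_vars_mem hx
    · intro H hH
      simp only [Finset.mem_filter, Finset.mem_univ, true_and] at hH ⊢
      exact ⟨⟨hH.2.2, hH.2.1.2.2 x hx⟩, self_mem_comp _ _⟩

/-- The number of clauses that encode arcs which leave `A`. -/
lemma card_clausesOut (hA : Consistent A) :
    (clausesOut A).card =
      (vars A).card.choose 2 + 2 * (vars A).card * (n - (vars A).card) := by
  obtain ⟨B, hB⟩ : ∃ B, B = A.image Literal.neg := ⟨_, rfl⟩
  have hmB : ∀ l, l ∈ B ↔ l.neg ∈ A := fun l => by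
    rw [hB, Finset.mem_image]
    exact ⟨by rintro ⟨k, hk, rfl⟩; rwa [Literal.neg_neg], fun h => ⟨_, h, l.neg_neg⟩⟩
  have hBcard : B.card = (vars A).card := by
    rw [hB, Finset.card_image_of_injective _ Literal.neg_injective, card_vars hA]
  obtain ⟨W, hW⟩ : ∃ W : Finset (Literal n), W = (Finset.univ \ vars A) ×ˢ Finset.univ := ⟨_, rfl⟩
  have hmW : ∀ l, l ∈ W ↔ l ∉ A ∧ l.neg ∉ A := fun l => by
    rw [hW, Finset.mem_product, Finset.mem_sdiff, mem_vars]
    simp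
  have hWcard : W.card = (n - (vars A).card) * 2 := by
    rw [hW, Finset.card_product, Finset.card_sdiff_of_subset (Finset.subset_univ _)]
    simp
  have hne : ∀ k ∈ B, ∀ l ∈ B, k ≠ l → k.1 ≠ l.1 := by
    intro k hk l hl hkl h
    rcases Literal.eq_or_eq_neg h with h | rfl
    · exact hkl h
    · rw [hmB, Literal.neg_neg] at hk
      exact hA _ hk ((hmB l).1 hl)
  -- With `B` the negation of `A`, a clause leaving `A` has either two literals in `B`, or one in
  -- `B` and one among the `2 * (n - (vars A).card)` literals on other variables.
  have hunion : clausesOut A =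
      B.offDiag.image Sym2.mk.uncurry ∪ (B ×ˢ W).image Sym2.mk.uncurry := by
    ext c
    induction c with | _ k l =>
    have hk := hA k
    have hl := hA l
    have hneg : ∀ k l : Literal n, k ∈ B → l ∈ W → k.1 ≠ l.1 := by
      intro k l hk hl h
      rw [hmB] at hk
      rw [hmW] at hl
      rcases Literal.eq_or_eq_neg h with rfl | rfl
      · exact hl.2 hk
      · rw [Literal.neg_neg] at hk
        exact hl.1 hk
    rw [mem_clausesOut, Finset.mem_union, Finset.mem_image, Finset.mem_image]
    constructor
    · rintro ⟨h1, ⟨h2, h3⟩, h4⟩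
      by_cases hkB : k.neg ∈ A
      · by_cases hlB : l.neg ∈ A
        · exact .inl ⟨(k, l), Finset.mem_offDiag.2 ⟨(hmB k).2 hkB, (hmB l).2 hlB,
            fun h => h1 (congrArg Prod.fst h)⟩, rfl⟩
        · exact .inr ⟨(k, l), Finset.mem_product.2 ⟨(hmB k).2 hkB, (hmW l).2 ⟨h3, hlB⟩⟩, rfl⟩
      · exact .inr ⟨(l, k), Finset.mem_product.2 ⟨(hmB l).2 (h4.resolve_left hkB),
          (hmW k).2 ⟨h2, hkB⟩⟩, Sym2.eq_swap⟩
    · have hnA : ∀ l, l ∈ B → l ∉ A := fun l hl h => hA l h ((hmB l).1 hl)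
      rintro (⟨⟨a, b⟩, hab, h⟩ | ⟨⟨a, b⟩, hab, h⟩)
      · obtain ⟨ha, hb, hn⟩ := Finset.mem_offDiag.1 hab
        have := hne a ha b hb hn
        rcases Sym2.eq_iff.1 h with ⟨rfl, rfl⟩ | ⟨rfl, rfl⟩
        · exact ⟨this, ⟨hnA _ ha, hnA _ hb⟩, .inl ((hmB _).1 ha)⟩
        · exact ⟨this.symm, ⟨hnA _ hb, hnA _ ha⟩, .inl ((hmB _).1 hb)⟩
      · obtain ⟨ha, hb⟩ := Finset.mem_product.1 hab
        have := hneg a b ha hb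
        rcases Sym2.eq_iff.1 h with ⟨rfl, rfl⟩ | ⟨rfl, rfl⟩
        · exact ⟨this, ⟨hnA _ ha, ((hmW _).1 hb).1⟩, .inl ((hmB _).1 ha)⟩
        · exact ⟨this.symm, ⟨((hmW _).1 hb).1, hnA _ ha⟩, .inr ((hmB _).1 ha)⟩
  have hBW : ∀ l, l ∈ B → l ∉ W := fun l hl h => ((hmW l).1 h).2 ((hmB l).1 hl)
  have hdisj : Disjoint (B.offDiag.image Sym2.mk.uncurry) ((B ×ˢ W).image Sym2.mk.uncurry) := by
    rw [Finset.disjoint_left]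
    intro c h1 h2
    obtain ⟨⟨a, b⟩, hab, rfl⟩ := Finset.mem_image.1 h1
    obtain ⟨⟨a', b'⟩, hab', h⟩ := Finset.mem_image.1 h2
    have h : s(a', b') = s(a, b) := h
    obtain ⟨ha, hb, -⟩ := Finset.mem_offDiag.1 hab
    obtain ⟨-, hb'⟩ := Finset.mem_product.1 hab'
    rcases Sym2.eq_iff.1 h with ⟨rfl, rfl⟩ | ⟨rfl, rfl⟩
    · exact hBW _ hb hb'
    · exact hBW _ ha hb'
  have hinj : Set.InjOn (Sym2.mk.uncurry : Literal n × Literal n → _)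
      ((B ×ˢ W : Finset (Literal n × Literal n)) : Set _) := by
    rintro ⟨a, b⟩ hab ⟨a', b'⟩ hab' h
    obtain ⟨ha, hb⟩ := Finset.mem_product.1 hab
    obtain ⟨ha', hb'⟩ := Finset.mem_product.1 hab'
    have h : s(a, b) = s(a', b') := h
    rcases Sym2.eq_iff.1 h with ⟨h1, h2⟩ | ⟨h1, h2⟩
    · exact Prod.ext h1 h2
    · exact absurd hb' (hBW _ (h1 ▸ ha))
  rw [hunion, Finset.card_union_of_disjoint hdisj, Sym2.card_image_offDiag,
    Finset.card_image_of_injOn hinj, Finset.card_product, hBcard, hWcard]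
  ring

end

/-! ### Comparison of the two counts and conclusion. -/

/-- The identity of the proposition, coefficient by coefficient. -/
lemma sum_choose_eq_expCoeff {S : DigraphFamily} {T : ImplicationFamily}
    (hS : IsOrdinarySCCFamily S) (hT : IsContradictorySCCFamily T) (n : ℕ) :
    ∑ k ∈ Finset.range (n + 1), ((n.choose k : ℚ) * 2 ^ k) •
      ((1 + X) ^ (k.choose 2 + 2 * k * (n - k)) * expCoeff (fun k => -digraphWeight S k) k *
        implicationWeight (cnfFamily S T) (n - k)) =
      expCoeff (fun k => implicationWeight T k - (2 ^ k / 2 : ℚ) • digraphWeight S k) n := by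
  have hd0 := digraphWeight_zero hS
  have hrhs : isolatedSum S T Finset.univ (Finset.univ : Finset (Fin n)) =
      expCoeff (fun k => implicationWeight T k - (2 ^ k / 2 : ℚ) • digraphWeight S k) n := by
    rw [isolatedSum_eq_expCoeff (a := fun k =>
      implicationWeight T k - (2 ^ k / 2 : ℚ) • digraphWeight S k) _ (by simp [hd0,
        implicationWeight_zero hT]) fun U _ hne => atomSum_univ hS hT hne, Finset.card_univ,
      Fintype.card_fin]
  rw [← hrhs, ← sum_consistent_eq_isolatedSum hS]
  let g : ℕ → PowerSeries ℚ := fun k => (1 + X) ^ (k.choose 2 + 2 * k * (n - k)) *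
    expCoeff (fun k => -digraphWeight S k) k * implicationWeight (cnfFamily S T) (n - k)
  have hterm : ∀ A ∈ Finset.univ.filter (fun A : Finset (Literal n) => Consistent A),
      (1 + X) ^ (clausesOut A).card * isolatedSum S T (clausesIn A) (vars A) *
        cnfSum S T (Finset.univ \ vars A) = g (vars A).card := by
    intro A hA
    have hA := (Finset.mem_filter.1 hA).2
    rw [card_clausesOut hA, cnfSum_eq, Finset.card_sdiff_of_subset (Finset.subset_univ _),
      Finset.card_univ, Fintype.card_fin,
      isolatedSum_eq_expCoeff (a := fun k => -digraphWeight S k) _ (by simp [hd0])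
        fun U hU hne => atomSum_clausesIn hS hA hU hne]
  -- The term depends on `A` only through its number `k` of variables; there are `n.choose k` sets
  -- of variables and `2 ^ k` choices of signs on each.
  rw [Finset.sum_congr rfl hterm, ← Finset.sum_fiberwise_of_maps_to (g := vars)
    (t := (Finset.univ : Finset (Fin n)).powerset) (fun A _ => by simp)]
  have hfib : ∀ U ∈ (Finset.univ : Finset (Fin n)).powerset,
      ∑ A ∈ (Finset.univ.filter fun A : Finset (Literal n) => Consistent A).filter
        (fun A => vars A = U), g (vars A).card = (2 ^ U.card : ℕ) • g U.card := by
    intro U _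
    rw [Finset.filter_filter, ← card_consistent_vars, ← Finset.sum_const]
    refine Finset.sum_congr rfl fun A hA => ?_
    rw [(Finset.mem_filter.1 hA).2.2]
  rw [Finset.sum_congr rfl hfib,
    Finset.sum_powerset_apply_card (fun k => (2 ^ k : ℕ) • g k), Finset.card_univ,
    Fintype.card_fin]
  refine Finset.sum_congr rfl fun k _ => ?_
  rw [smul_smul, ← Nat.cast_smul_eq_nsmul ℚ]
  push_cast
  rfl

end TwoSat

theorem mainTheorem1 (S : TwoSat.DigraphFamily) (T : TwoSat.ImplicationFamily)
    (hS : TwoSat.IsOrdinarySCCFamily S) (hT : TwoSat.IsContradictorySCCFamily T)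
    (Scc Cscc num den : TwoSat.Series)
    (hScc : Scc = TwoSat.egf (TwoSat.digraphWeight S))
    (hCscc : Cscc = TwoSat.egf (TwoSat.implicationWeight T))
    (hnum : num = TwoSat.hadamard
      (TwoSat.expSeries (Cscc - (1 / 2 : ℚ) • PowerSeries.rescale (2 : PowerSeries ℚ) Scc))
      TwoSat.setImplication)
    (hden : den = TwoSat.hadamard (TwoSat.expSeries (-Scc)) TwoSat.setGraphic) :
    IsUnit den ∧
    TwoSat.implicationGF (TwoSat.implicationWeight (TwoSat.cnfFamily S T)) =
      num * Ring.inverse den := by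
  have hu : IsUnit den := by
    rw [hden, hScc]
    exact TwoSat.isUnit_hadamard_setGraphic _ (TwoSat.digraphWeight_zero hS)
  refine ⟨hu, ?_⟩
  have h := TwoSat.algebraic_identity _ _ _ (TwoSat.sum_choose_eq_expCoeff hS hT)
  rw [← hScc, ← hCscc, ← hnum, ← hden] at h
  -- `Ring.inverse` takes the value `0` on non-units, so the cancellation relies on the denominator
  -- being a unit.
  rw [← h, mul_assoc, Ring.mul_inverse_cancel _ hu, mul_one]
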